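/- Let $\phi=\frac{1+\sqrt5}{2}$. Consider kites and darts with edges of lengths $1$ and $\phi$: the kite has the vertices $0,\ \phi e^{i\pi/5},\ \phi,\ \phi e^{-i\pi/5}$ and the dart has the vertices $0,\ \phi e^{i\pi/5},\ 1,\ \phi e^{-i\pi/5}$ (in this cyclic order, in $\mathbb{C}=\mathbb{R}^2$), up to congruence. Label the two vertices $\phi e^{\pm i\pi/5}$ of the kite by $H$ and its other two vertices by $T$; label the two vertices $\phi e^{\pm i\pi/5}$ of the dart by $T$ and its other two vertices by $H$. A (kite–dart) Penrose tiling is a covering of the plane by kites and darts with pairwise disjoint interiors, fitted together edge to edge so that the labels at the ends of each common edge agree. Let $\tau$ be a Penrose tiling and let $Y\subseteq\mathbb{R}^2$ be a separated net created by $\tau$: $Y$ is obtained by choosing one point in each (closed) tile, with different points for different tiles, and there are $c_1,c_2>0$ such that $d(x,y)\ge c_1$ for all distinct $x,y\in Y$ and every $x\in\mathbb{R}^2$ has some $y\in Y$ with $d(x,y)\le c_2$. For $\rho>0$ and a square $\mathcal{U}$ of area $|\mathcal U|$ put $$e_\rho(\mathcal{U})=\max\Big\{\frac{\rho|\mathcal{U}|}{\sharp(\mathcal{U}\cap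 Y)},\ \frac{\sharp(\mathcal{U}\cap Y)}{\rho|\mathcal{U}|}\Big\}\in[1,\infty]$$ (with value $\infty$ if $\mathcal{U}\cap Y=\emptyset$), and let $E_\rho(2^i)$ be the supremum of $e_\rho(\mathcal{U})$ over all squares $\mathcal{U}=[j_1,j_1+2^i]\times[j_2,j_2+2^i]$ with $j_1,j_2\in\mathbb{N}=\{0,1,2,\dots\}$. Let $\psi$ be the area of a dart and $\rho=\frac{\phi^2}{(1+\phi^2)\psi}$. Then the product $\prod_{i\ge2}E_\rho(2^i)$ converges, that is, its partial products tend to a finite nonzero limit. If moreover every square $[j_1,j_1+2]\times[j_2,j_2+2]$ with $j_1,j_2\in\mathbb{N}$ contains a point of $Y$, then the whole product $\prod_{i\ge1}E_\rho(2^i)$ converges in the same sense. -/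

import Mathlib

open scoped ENNReal NNReal goldenRatio

/-! The Euclidean plane is `ℂ`, with its usual distance and Lebesgue measure. -/

namespace Penrose

noncomputable section

/-- The two shapes of tiles. -/
inductive Kind : Type
  | kite
  | dart

/-- A kite or a dart with edges of lengths `1` and `φ`, placed in the plane. `apex` is the vertex in
which the two long edges meet and `dir` is the direction of the symmetry axis, from the apex to the
opposite vertex. Both shapes are mirror symmetric, so every congruent copy of them arises in this
way, from exactly one such triple. -/
structure Tile : Type where
  kind : Kind
  apex : ℂ
  dir : Circle

/-- The length of the symmetry axis: `φ` for the kite and `1` for the dart. -/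
def Kind.axis : Kind → ℝ
  | .kite => φ
  | .dart => 1

/-- The vertex opposite to the apex: the vertex of the kite with the angle `144°`, the vertex of the
dart with the reflex angle `216°`. -/
def Tile.opp (T : Tile) : ℂ := T.apex + T.dir * (T.kind.axis : ℂ)

/-- The vertex at distance `φ` from the apex, to the left of the symmetry axis. -/
def Tile.wingL (T : Tile) : ℂ :=
  T.apex + T.dir * ((φ : ℂ) * Complex.exp (((Real.pi / 5 : ℝ) : ℂ) * Complex.I))

/-- The vertex at distance `φ` from the apex, to the right of the symmetry axis. -/
def Tile.wingR (T : Tile) : ℂ :=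
  T.apex + T.dir * ((φ : ℂ) * Complex.exp (((-(Real.pi / 5) : ℝ) : ℂ) * Complex.I))

/-- The closed region covered by a tile, the union of its two halves with respect to the symmetry
axis. -/
def Tile.region (T : Tile) : Set ℂ :=
  convexHull ℝ {T.apex, T.wingL, T.opp} ∪ convexHull ℝ {T.apex, T.wingR, T.opp}

/-- The four edges of a tile. The vertices of the tiles carry Conway's labels `H` and `T`: the kite
has `H` at its two wings and `T` at the two vertices on its axis, the dart has `T` at its two wings
and `H` at the two vertices on its axis. So each edge has one end labelled `H` and one end labelled
`T`; it is recorded as the pair (end labelled `H`, end labelled `T`). -/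
def Tile.edges (T : Tile) : Set (ℂ × ℂ) :=
  match T.kind with
  | .kite => {(T.wingL, T.apex), (T.wingR, T.apex), (T.wingL, T.opp), (T.wingR, T.opp)}
  | .dart => {(T.apex, T.wingL), (T.apex, T.wingR), (T.opp, T.wingL), (T.opp, T.wingR)}

/-- A set of kites and darts is a Penrose tiling of the plane: the tiles cover the plane, they do
not overlap, and they are fitted together edge to edge with matching labels. -/
structure IsPenroseTiling (τ : Set Tile) : Prop where
  covers : (⋃ T ∈ τ, T.region) = Set.univ
  disjoint_interiors : τ.PairwiseDisjoint fun T => interior T.region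
  matching : ∀ T ∈ τ, ∀ e ∈ T.edges, ∃ T' ∈ τ, T' ≠ T ∧ e ∈ T'.edges

/-- A separated net in the plane. -/
def IsSeparatedNet (Y : Set ℂ) : Prop :=
  ∃ c₁ c₂ : ℝ, 0 < c₁ ∧ 0 < c₂ ∧ (∀ x ∈ Y, ∀ y ∈ Y, x ≠ y → c₁ ≤ dist x y) ∧
    ∀ x : ℂ, ∃ y ∈ Y, dist x y ≤ c₂

/-- `Y` is a separated net created by the tiling `τ`: it is a separated net that is obtained by
placing one point in each tile, with different points for different tiles. -/
def IsNetCreatedBy (Y : Set ℂ) (τ : Set Tile) : Prop :=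
  IsSeparatedNet Y ∧
    ∃ p : Tile → ℂ, (∀ T ∈ τ, p T ∈ T.region) ∧ Set.InjOn p τ ∧ Y = p '' τ

/-- The square `[j₁, j₁ + 2 ^ i] × [j₂, j₂ + 2 ^ i]`. -/
def square (i j₁ j₂ : ℕ) : Set ℂ :=
  Set.Icc (j₁ : ℝ) (j₁ + 2 ^ i) ×ℂ Set.Icc (j₂ : ℝ) (j₂ + 2 ^ i)

/-- `e_ρ(U)`, the maximum of `ρ |U| / #(U ∩ Y)` and `#(U ∩ Y) / (ρ |U|)`. It is infinite if `U` has
positive area and contains no point of `Y`. -/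
def e (Y : Set ℂ) (ρ : ℝ) (U : Set ℂ) : ℝ≥0∞ :=
  max (ENNReal.ofReal ρ * MeasureTheory.volume U / ((U ∩ Y).encard : ℝ≥0∞))
    (((U ∩ Y).encard : ℝ≥0∞) / (ENNReal.ofReal ρ * MeasureTheory.volume U))

/-- `E_ρ(2 ^ i)`, the supremum of `e_ρ` over the squares with edge `2 ^ i`. -/
def E (Y : Set ℂ) (ρ : ℝ) (i : ℕ) : ℝ≥0∞ :=
  ⨆ (j₁ : ℕ) (j₂ : ℕ), e Y ρ (square i j₁ j₂)

/-- The infinite product `∏_{i ≥ k} a i` converges: its partial products tend to a finite limit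
different from `0`. -/
def ProductConverges (k : ℕ) (a : ℕ → ℝ≥0∞) : Prop :=
  ∃ L : ℝ≥0, 0 < L ∧
    Filter.Tendsto (fun n => ∏ i ∈ Finset.Icc k n, a i) Filter.atTop (nhds (L : ℝ≥0∞))

/-- `ψ`, the area of a dart. -/
def dartArea : ℝ := (MeasureTheory.volume (Tile.region ⟨.dart, 0, 1⟩)).toReal

end

end Penrose

namespace Penrose

noncomputable section

set_option linter.unusedSimpArgs false

open MeasureTheory

/-! A square of side R contains ρR² + O(R) points of the net. Hence 1 ≤ E_ρ(2^i) ≤ 1 + c/2^i for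
large i, and the product converges as soon as the finitely many earlier factors are finite
(`productConverges_of_le`).

For the count, let K and D be the numbers of kites and darts whose points lie in the square. A kite
has φ times the area of a dart, so comparing areas gives φK + D = R²/ψ + O(R). A second relation, (φ
- 1)K - D = O(R), then determines K + D. It is the Galois conjugate of an area computation: an
additive map `S` of ℂ, semilinear for zeta ↦ zeta³ (so φ ↦ 1 - φ), turns kites and darts into
polygons with signed areas in the proportion 1 - φ to 1. Written as sums over directed edges, these
areas cancel along the inner edges of a patch. The O(R) boundary edges contribute O(1) each,
provided that `S` is bounded on the vertices (`exists_conjWeight_bound`).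

This boundedness (`exists_conj_bound`) is the heart of the proof and comes from Ammann bars. Every
tile carries segments that continue straight across the edges, so they form lines, and the
conjugates of the segment ends on one line are again collinear. Where a line from a tile T crosses a
line from a fixed tile T₀ there is a tile that shares one coordinate with T and another with T₀, in
the plane and under `S`, up to bounded errors (`exists_mix`). The coordinates in the directions
zeta^n, zeta^(n+2), zeta^(n+8) are linearly dependent. So passing from T to the crossing tile, and
from direction n to n + 2, multiplies the plane coordinate by φ - 1 and the conjugate one by -φ, up
to bounded errors. Under iteration the plane coordinates stay bounded, while a conjugate coordinate
that is too large would grow without limit, against local finiteness. -/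

/-- The edges of a tile: the first entry says whether the edge is long, the second whether it ends
in the left wing. -/
abbrev Edge : Type := Bool × Bool

/-! ### Coordinates over ℚ(φ) and the tenth roots of unity -/

/-- The primitive tenth root of unity `exp (π i / 5)`. -/
def zeta : ℂ := Complex.exp (((Real.pi / 5 : ℝ) : ℂ) * Complex.I)

/-- The modulus of `zeta - zeta⁻¹`. -/
def chord : ℝ := 2 * Real.sin (Real.pi / 5)

/-- The point with the coordinates `x` and `y` with respect to `1` and `zeta - zeta⁻¹`. -/
def pt (x y : ℝ) : ℂ := ⟨x, chord * y⟩

/-- The tenth roots of unity. -/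
def unit (n : ZMod 10) : ℂ := zeta ^ n.val

lemma phi_sq : φ ^ 2 = φ + 1 := Real.goldenRatio_sq

lemma phi_gt : (1.618 : ℝ) < φ := by
  have h : (2.236 : ℝ) < √5 := Real.lt_sqrt_of_sq_lt (by norm_num)
  unfold Real.goldenRatio; linarith

lemma phi_lt : φ < (1.6181 : ℝ) := by
  have h : √5 < (2.2362 : ℝ) := (Real.sqrt_lt' (by norm_num)).2 (by norm_num)
  unfold Real.goldenRatio; linarith

lemma chord_pos : 0 < chord := by
  have := Real.sin_pos_of_pos_of_lt_pi (x := Real.pi / 5) (by positivity)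
    (by linarith [Real.pi_pos])
  unfold chord; linarith

lemma cos_pi_div_five' : Real.cos (Real.pi / 5) = φ / 2 := by
  rw [Real.cos_pi_div_five, Real.goldenRatio]; ring

lemma chord_sq : chord ^ 2 = 3 - φ := by
  have h := Real.sin_sq_add_cos_sq (Real.pi / 5)
  rw [cos_pi_div_five'] at h
  unfold chord
  nlinarith [phi_sq]

lemma pt_add (a b c d : ℝ) : pt a b + pt c d = pt (a + c) (b + d) := by
  apply Complex.ext <;> simp [pt]; ring

lemma pt_sub (a b c d : ℝ) : pt a b - pt c d = pt (a - c) (b - d) := by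
  apply Complex.ext <;> simp [pt]; ring

lemma pt_neg (a b : ℝ) : -pt a b = pt (-a) (-b) := by
  apply Complex.ext <;> simp [pt]

lemma pt_mul (a b c d : ℝ) :
    pt a b * pt c d = pt (a * c + (φ - 3) * b * d) (a * d + b * c) := by
  apply Complex.ext <;> simp [pt]
  · linear_combination (-b * d) * chord_sq
  · ring

lemma ofReal_eq_pt (a : ℝ) : (a : ℂ) = pt a 0 := by
  apply Complex.ext <;> simp [pt]

lemma one_eq_pt : (1 : ℂ) = pt 1 0 := by
  apply Complex.ext <;> simp [pt]

lemma pt_zero : pt 0 0 = 0 := by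
  apply Complex.ext <;> simp [pt]

lemma zeta_eq_pt : zeta = pt (φ / 2) (1 / 2) := by
  unfold zeta
  rw [Complex.exp_mul_I, ← Complex.ofReal_cos, ← Complex.ofReal_sin, cos_pi_div_five']
  apply Complex.ext <;> simp only [pt, chord, Complex.add_re, Complex.add_im, Complex.ofReal_re,
    Complex.ofReal_im, Complex.re_ofReal_mul, Complex.im_ofReal_mul, Complex.I_re, Complex.I_im] <;>
    ring

lemma pt_congr {a b c d : ℝ} (h₁ : a = c) (h₂ : b = d) : pt a b = pt c d := by rw [h₁, h₂]

lemma pt_inj {a b c d : ℝ} (h : pt a b = pt c d) : a = c ∧ b = d := by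
  have h₁ := congrArg Complex.re h
  have h₂ := congrArg Complex.im h
  simp only [pt] at h₁ h₂
  exact ⟨h₁, mul_left_cancel₀ chord_pos.ne' h₂⟩

/-- The coordinates of the tenth roots of unity. -/
def unitCoord : ZMod 10 → ℝ × ℝ :=
  ![(1, 0), (φ / 2, 1 / 2), ((φ - 1) / 2, φ / 2), ((1 - φ) / 2, φ / 2), (-φ / 2, 1 / 2),
    (-1, 0), (-φ / 2, -1 / 2), ((1 - φ) / 2, -φ / 2), ((φ - 1) / 2, -φ / 2), (φ / 2, -1 / 2)]

lemma unitCoord_table :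
    unitCoord 0 = (1, 0) ∧
    unitCoord 1 = (φ / 2, 1 / 2) ∧
    unitCoord 2 = ((φ - 1) / 2, φ / 2) ∧
    unitCoord 3 = ((1 - φ) / 2, φ / 2) ∧
    unitCoord 4 = (-φ / 2, 1 / 2) ∧
    unitCoord 5 = (-1, 0) ∧
    unitCoord 6 = (-φ / 2, -1 / 2) ∧
    unitCoord 7 = ((1 - φ) / 2, -φ / 2) ∧
    unitCoord 8 = ((φ - 1) / 2, -φ / 2) ∧
    unitCoord 9 = (φ / 2, -1 / 2) :=
  ⟨rfl, rfl, rfl, rfl, rfl, rfl, rfl, rfl, rfl, rfl⟩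

lemma forall_zmod {P : ZMod 10 → Prop}
    (h : P 0 ∧ P 1 ∧ P 2 ∧ P 3 ∧ P 4 ∧ P 5 ∧ P 6 ∧ P 7 ∧ P 8 ∧ P 9)
    (n : ZMod 10) : P n := by
  obtain ⟨h0, h1, h2, h3, h4, h5, h6, h7, h8, h9⟩ := h
  fin_cases n <;> assumption

lemma unitCoord_succ (n : ZMod 10) :
    pt (unitCoord n).1 (unitCoord n).2 * zeta = pt (unitCoord (n + 1)).1 (unitCoord (n + 1)).2 := by
  rw [zeta_eq_pt, pt_mul]
  revert n
  refine forall_zmod ⟨?_, ?_, ?_, ?_, ?_, ?_, ?_, ?_, ?_, ?_⟩ <;> reduce_mod_char <;>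
    simp only [unitCoord_table] <;> apply pt_congr <;> linarith [phi_sq]

lemma zeta_pow (n : ℕ) : zeta ^ n = pt (unitCoord n).1 (unitCoord n).2 := by
  induction n with
  | zero => rw [pow_zero, one_eq_pt]; rfl
  | succ n ih => rw [pow_succ, ih, unitCoord_succ]; push_cast; rfl

lemma unit_eq_pt (n : ZMod 10) : unit n = pt (unitCoord n).1 (unitCoord n).2 := by
  rw [unit, zeta_pow, ZMod.natCast_zmod_val]

lemma zeta_pow_ten : zeta ^ 10 = 1 := by
  rw [zeta_pow, one_eq_pt]; rfl

lemma unit_add (m n : ZMod 10) : unit (m + n) = unit m * unit n := by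
  unfold unit
  rw [← pow_add, ZMod.val_add]
  conv_rhs => rw [← Nat.div_add_mod (m.val + n.val) 10, pow_add, pow_mul, zeta_pow_ten, one_pow,
    one_mul]

lemma unit_one : unit 1 = zeta := by
  unfold unit; rw [show (1 : ZMod 10).val = 1 from rfl, pow_one]

lemma unit_zero : unit 0 = 1 := by
  unfold unit; rw [show (0 : ZMod 10).val = 0 from rfl, pow_zero]

/-! ### Edges of tiles in coordinates -/

/-- The length of an edge. -/
def edgeLen (k : Edge) : ℝ := if k.1 then φ else 1

/-- The direction of an edge, from its end labelled `H` to its end labelled `T`, in the frame of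
the tile, as an exponent of `zeta`. -/
def edgeDir : Kind → Edge → ZMod 10
  | .kite, (true, true) => 6
  | .kite, (true, false) => 4
  | .kite, (false, true) => 8
  | .kite, (false, false) => 2
  | .dart, (true, true) => 1
  | .dart, (true, false) => 9
  | .dart, (false, true) => 2
  | .dart, (false, false) => 8

/-- Whether the tile lies to the left of an edge that is directed from `H` to `T`. -/
def edgeLeft : Kind → Edge → Bool
  | .kite, k => k.1 == k.2
  | .dart, k => k.1 != k.2

/-- The coordinates of a wing. -/
def wingCoord (left : Bool) : ℝ × ℝ := ((φ + 1) / 2, if left then φ / 2 else -φ / 2)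

/-- The coordinates of the end labelled `H` of an edge. -/
def headCoord : Kind → Edge → ℝ × ℝ
  | .kite, k => wingCoord k.2
  | .dart, k => (if k.1 then 0 else 1, 0)

/-- The coordinates of the end labelled `T` of an edge. -/
def tailCoord : Kind → Edge → ℝ × ℝ
  | .kite, k => (if k.1 then 0 else φ, 0)
  | .dart, k => wingCoord k.2

/-- The point with the given coordinates in the frame of the tile. -/
def Tile.point (T : Tile) (x y : ℝ) : ℂ := T.apex + T.dir * pt x y

/-- The end labelled `H` of an edge. -/
def Tile.head (T : Tile) (k : Edge) : ℂ := T.point (headCoord T.kind k).1 (headCoord T.kind k).2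

/-- The end labelled `T` of an edge. -/
def Tile.tail (T : Tile) (k : Edge) : ℂ := T.point (tailCoord T.kind k).1 (tailCoord T.kind k).2

/-- The direction of an edge, from `H` to `T`. -/
def Tile.edgeVec (T : Tile) (k : Edge) : ℂ := T.dir * unit (edgeDir T.kind k)

lemma pt_tailCoord (K : Kind) (k : Edge) :
    pt (tailCoord K k).1 (tailCoord K k).2 =
      pt (headCoord K k).1 (headCoord K k).2 + unit (edgeDir K k) * (edgeLen k : ℂ) := by
  obtain ⟨l, s⟩ := k
  rw [unit_eq_pt, ofReal_eq_pt, pt_mul, pt_add]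
  cases K <;> cases l <;> cases s <;>
    simp only [tailCoord, headCoord, edgeDir, edgeLen, wingCoord, unitCoord_table, if_true,
      Bool.false_eq_true, if_false] <;>
    apply pt_congr <;> linarith [phi_sq]

lemma Tile.tail_eq (T : Tile) (k : Edge) :
    T.tail k = T.head k + T.edgeVec k * (edgeLen k : ℂ) := by
  rw [tail, head, point, point, pt_tailCoord, edgeVec]; ring

lemma exp_neg_pi_div_five :
    Complex.exp (((-(Real.pi / 5) : ℝ) : ℂ) * Complex.I) = pt (φ / 2) (-1 / 2) := by
  rw [Complex.exp_mul_I, ← Complex.ofReal_cos, ← Complex.ofReal_sin, Real.cos_neg, Real.sin_neg,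
    cos_pi_div_five']
  apply Complex.ext <;> simp only [pt, chord, Complex.add_re, Complex.add_im, Complex.ofReal_re,
    Complex.ofReal_im, Complex.re_ofReal_mul, Complex.im_ofReal_mul, Complex.I_re, Complex.I_im] <;>
    ring

lemma Tile.wingL_eq (T : Tile) : T.wingL = T.point ((φ + 1) / 2) (φ / 2) := by
  have : Complex.exp (((Real.pi / 5 : ℝ) : ℂ) * Complex.I) = pt (φ / 2) (1 / 2) := zeta_eq_pt
  rw [wingL, this, point, ofReal_eq_pt, pt_mul]
  congr 2
  apply pt_congr <;> linarith [phi_sq]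

lemma Tile.wingR_eq (T : Tile) : T.wingR = T.point ((φ + 1) / 2) (-φ / 2) := by
  rw [wingR, exp_neg_pi_div_five, point, ofReal_eq_pt, pt_mul]
  congr 2
  apply pt_congr <;> linarith [phi_sq]

lemma Tile.opp_eq (T : Tile) : T.opp = T.point T.kind.axis 0 := by
  rw [opp, point, ofReal_eq_pt]

lemma Tile.apex_eq (T : Tile) : T.apex = T.point 0 0 := by
  simp [point, pt_zero]

lemma Tile.mem_edges_iff (T : Tile) (e : ℂ × ℂ) :
    e ∈ T.edges ↔ ∃ k, e = (T.head k, T.tail k) := by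
  obtain ⟨K, a, d⟩ := T
  cases K <;> simp only [Tile.edges, Set.mem_insert_iff, Set.mem_singleton_iff, Prod.exists,
    Bool.exists_bool, Tile.head, Tile.tail, headCoord, tailCoord, wingCoord, Tile.wingL_eq,
    Tile.wingR_eq, Tile.opp_eq, Kind.axis, if_true, Bool.false_eq_true, if_false]
  all_goals
    simp only [Tile.point, pt_zero, mul_zero, add_zero]
    tauto

/-! ### Regions of tiles and their interiors -/

lemma mem_convexHull_triple {a b c : ℂ} {α β γ : ℝ} (hα : 0 ≤ α) (hβ : 0 ≤ β) (hγ : 0 ≤ γ)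
    (h : α + β + γ = 1) : (α : ℂ) * a + β * b + γ * c ∈ convexHull ℝ {a, b, c} := by
  have := (convex_convexHull ℝ {a, b, c}).sum_mem (t := Finset.univ) (w := ![α, β, γ])
    (z := ![a, b, c]) (by intro i _; fin_cases i <;> assumption)
    (by simp [Fin.sum_univ_three, h])
    (by intro i _; apply subset_convexHull; fin_cases i <;> simp)
  simpa [Fin.sum_univ_three] using this

/-- The condition that a point with the given coordinates lies on the inner side of the line of a
short edge. -/
def Kind.cap : Kind → ℝ → ℝ → Prop
  | .kite, x, y => x + (2 - φ) * y ≤ φ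
  | .dart, x, y => x - (2 - φ) * y ≤ 1

/-- Barycentric coordinates with respect to the three vertices. The values 1 and -1 of `s` give the
left and the right half of the tile. -/
lemma Tile.point_mem_hull {T : Tile} {x y : ℝ} (hy : 0 ≤ y) (hx : φ * y ≤ x) (h : T.kind.cap x y)
    (s : ℝ) : T.point x (s * y) ∈
      convexHull ℝ {T.point 0 0, T.point ((φ + 1) / 2) (s * (φ / 2)), T.point T.kind.axis 0} := by
  have hφ := phi_gt
  have hA : 0 < T.kind.axis := by cases T.kind <;> simp only [Kind.axis] <;> linarith
  have e1 : 2 / φ = 2 * (φ - 1) := by rw [div_eq_iff (by linarith)]; linear_combination -2 * phi_sq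
  have key := mem_convexHull_triple (a := T.point 0 0) (b := T.point ((φ + 1) / 2) (s * (φ / 2)))
    (c := T.point T.kind.axis 0) (α := 1 - 2 / φ * y - (x - φ * y) / T.kind.axis) (β := 2 / φ * y)
    (γ := (x - φ * y) / T.kind.axis) ?_ (by positivity)
    (div_nonneg (by linarith) hA.le) (by ring)
  · convert key using 1
    have hA' : (x - φ * y) / T.kind.axis * T.kind.axis = x - φ * y := div_mul_cancel₀ _ hA.ne'
    simp only [Tile.point, ofReal_eq_pt]
    have : pt x (s * y) = pt (2 / φ * y) 0 * pt ((φ + 1) / 2) (s * (φ / 2))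
        + pt ((x - φ * y) / T.kind.axis) 0 * pt T.kind.axis 0 := by
      rw [pt_mul, pt_mul, pt_add]
      apply pt_congr
      · rw [hA', e1]; linear_combination (-y) * phi_sq
      · field_simp; ring
    rw [this]
    have h1 : pt (1 - 2 / φ * y - (x - φ * y) / T.kind.axis) 0
      = 1 - pt (2 / φ * y) 0 - pt ((x - φ * y) / T.kind.axis) 0 := by
      rw [one_eq_pt, pt_sub, pt_sub, sub_zero, sub_zero]
    rw [h1, pt_zero]; ring
  · rw [e1]
    revert h hA
    cases T.kind <;> simp only [Kind.axis, Kind.cap] <;> intro h hA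
    · have : (x - φ * y) / φ = (x - φ * y) * (φ - 1) := by
        rw [div_eq_iff (by linarith)]; linear_combination -(x - φ * y) * phi_sq
      rw [this]
      nlinarith [phi_sq, mul_le_mul_of_nonneg_left h (by linarith : 0 ≤ φ - 1)]
    · rw [div_one]; nlinarith

lemma Tile.mem_region_of_nonneg {T : Tile} {x y : ℝ} (hy : 0 ≤ y) (hx : φ * y ≤ x)
    (h : T.kind.cap x y) : T.point x y ∈ T.region := by
  left
  rw [apex_eq, wingL_eq, opp_eq]
  simpa using point_mem_hull hy hx h 1

lemma Tile.mem_region_of_nonpos {T : Tile} {x y : ℝ} (hy : y ≤ 0) (hx : -φ * y ≤ x)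
    (h : T.kind.cap x (-y)) : T.point x y ∈ T.region := by
  right
  rw [apex_eq, wingR_eq, opp_eq]
  have := point_mem_hull (T := T) (y := -y) (by linarith) (by linarith) h (-1)
  simpa [neg_div] using this

lemma Tile.mem_region {T : Tile} {x y : ℝ} (hx : φ * |y| ≤ x) (h : T.kind.cap x |y|) :
    T.point x y ∈ T.region := by
  rcases le_total 0 y with hy | hy
  · rw [abs_of_nonneg hy] at hx h; exact mem_region_of_nonneg hy hx h
  · rw [abs_of_nonpos hy] at hx h; exact mem_region_of_nonpos hy (by linarith) h

lemma mul_conj_of_norm {d : ℂ} (hd : ‖d‖ = 1) : d * (starRingEnd ℂ) d = 1 := by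
  rw [Complex.mul_conj, Complex.normSq_eq_norm_sq, hd]; simp

lemma eq_add_mul_pt {d : ℂ} (hd : ‖d‖ = 1) (h z : ℂ) :
    z = h + d * pt ((starRingEnd ℂ d * (z - h)).re) ((starRingEnd ℂ d * (z - h)).im / chord) := by
  have : pt ((starRingEnd ℂ d * (z - h)).re) ((starRingEnd ℂ d * (z - h)).im / chord)
      = starRingEnd ℂ d * (z - h) := by
    apply Complex.ext <;> simp only [pt]
    field_simp [chord_pos.ne']
  rw [this, ← mul_assoc, mul_conj_of_norm hd]; ring

/-- A subset of the plane that is open in coordinates with respect to an orthogonal frame is a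
neighbourhood of its points. -/
lemma mem_nhds_of_coord {d : ℂ} (hd : ‖d‖ = 1) (h : ℂ) {U : Set (ℝ × ℝ)} (hU : IsOpen U) {R : Set ℂ}
    (hR : ∀ p ∈ U, h + d * pt p.1 p.2 ∈ R) {x y : ℝ} (hp : (x, y) ∈ U) :
    h + d * pt x y ∈ interior R := by
  let f : ℂ → ℝ × ℝ := fun z =>
    ((starRingEnd ℂ d * (z - h)).re, (starRingEnd ℂ d * (z - h)).im / chord)
  have hf : Continuous f := by
    have : Continuous fun z : ℂ => starRingEnd ℂ d * (z - h) := by fun_prop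
    exact (Complex.continuous_re.comp this).prodMk
      ((Complex.continuous_im.comp this).div_const _)
  refine mem_interior.2 ⟨f ⁻¹' U, fun z hz => ?_, hU.preimage hf, ?_⟩
  · rw [eq_add_mul_pt hd h z]; exact hR _ hz
  · have : f (h + d * pt x y) = (x, y) := by
      simp only [f, add_sub_cancel_left]
      rw [← mul_assoc, mul_comm (starRingEnd ℂ _), mul_conj_of_norm hd, one_mul]
      simp [pt, chord_pos.ne']
    change f _ ∈ U
    rwa [this]

lemma Tile.mem_interior_kite {T : Tile} (hT : T.kind = .kite) {x y : ℝ} (h₁ : φ * y < x)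
    (h₂ : -φ * y < x) (h₃ : x + (2 - φ) * y < φ) (h₄ : x - (2 - φ) * y < φ) :
    T.point x y ∈ interior T.region := by
  refine mem_nhds_of_coord (Circle.norm_coe T.dir) T.apex
    (U := {p | φ * p.2 < p.1} ∩ {p | -φ * p.2 < p.1} ∩
    {p | p.1 + (2 - φ) * p.2 < φ} ∩ {p | p.1 - (2 - φ) * p.2 < φ}) ?_ ?_ ⟨⟨⟨h₁, h₂⟩, h₃⟩, h₄⟩
  · refine IsOpen.inter (IsOpen.inter (IsOpen.inter ?_ ?_) ?_) ?_ <;>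
      exact isOpen_lt (by fun_prop) (by fun_prop)
  · rintro ⟨x, y⟩ ⟨⟨⟨h₁, h₂⟩, h₃⟩, h₄⟩
    simp only [Set.mem_ofPred_eq] at h₁ h₂ h₃ h₄
    apply mem_region
    · rcases abs_cases y with h | h <;> rw [h.1] <;> linarith
    · rw [hT]; simp only [Kind.cap]
      rcases abs_cases y with h | h <;> rw [h.1] <;> linarith

lemma Tile.mem_interior_dart {T : Tile} (hT : T.kind = .dart) {x y : ℝ} (h₁ : φ * y < x)
    (h₂ : -φ * y < x) (h₃ : x - (2 - φ) * |y| < 1) : T.point x y ∈ interior T.region := by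
  refine mem_nhds_of_coord (Circle.norm_coe T.dir) T.apex
    (U := {p | φ * p.2 < p.1} ∩ {p | -φ * p.2 < p.1} ∩
    {p | p.1 - (2 - φ) * |p.2| < 1}) ?_ ?_ ⟨⟨h₁, h₂⟩, h₃⟩
  · refine IsOpen.inter (IsOpen.inter ?_ ?_) ?_ <;>
      exact isOpen_lt (by fun_prop) (by fun_prop)
  · rintro ⟨x, y⟩ ⟨⟨h₁, h₂⟩, h₃⟩
    simp only [Set.mem_ofPred_eq] at h₁ h₂ h₃
    apply mem_region
    · rcases abs_cases y with h | h <;> rw [h.1] <;> linarith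
    · rw [hT]; exact h₃.le

/-- The coordinates, in the frame of the tile, of a point given by coordinates along an edge. -/
def edgeCoord (K : Kind) (k : Edge) (t y : ℝ) : ℝ × ℝ :=
  ((headCoord K k).1 + (unitCoord (edgeDir K k)).1 * t
      + (φ - 3) * (unitCoord (edgeDir K k)).2 * y,
    (headCoord K k).2 + (unitCoord (edgeDir K k)).1 * y + (unitCoord (edgeDir K k)).2 * t)

lemma Tile.head_add (T : Tile) (k : Edge) (t y : ℝ) :
    T.head k + T.edgeVec k * pt t y
      = T.point (edgeCoord T.kind k t y).1 (edgeCoord T.kind k t y).2 := by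
  rw [head, edgeVec, point, point, unit_eq_pt, edgeCoord, mul_assoc, pt_mul, add_assoc, ← mul_add,
    pt_add]
  congr 2
  apply pt_congr <;> ring

/-- A flat triangle over an edge is contained in the tile. -/
lemma Tile.edge_strip (T : Tile) (k : Edge) {t y : ℝ} (hy : 0 ≤ y) (h₁ : 4 * y ≤ t)
    (h₂ : 4 * y ≤ edgeLen k - t) :
    T.head k + T.edgeVec k * pt t (if edgeLeft T.kind k then y else -y) ∈ T.region := by
  rw [head_add]
  obtain ⟨K, a, d⟩ := T
  obtain ⟨l, s⟩ := k
  have g := phi_gt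
  have g' := phi_lt
  have p := phi_sq
  -- Only φ² = φ + 1 and the two decimal bounds on φ matter. These products supply the nonlinear
  -- terms, so that after `φ` is generalized each condition is linear arithmetic.
  have p1 : φ ^ 2 * t = φ * t + t := by rw [p]; ring
  have p2 : φ ^ 2 * y = φ * y + y := by rw [p]; ring
  have q1 := mul_nonneg (sub_nonneg.2 g.le) hy
  have q2 := mul_nonneg (sub_nonneg.2 g'.le) hy
  have q3 := mul_nonneg (sub_nonneg.2 g.le) (sub_nonneg.2 h₁)
  have q4 := mul_nonneg (sub_nonneg.2 g'.le) (sub_nonneg.2 h₁)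
  have q5 := mul_nonneg (sub_nonneg.2 g.le) (sub_nonneg.2 h₂)
  have q6 := mul_nonneg (sub_nonneg.2 g'.le) (sub_nonneg.2 h₂)
  cases s
  · apply mem_region_of_nonpos <;> cases K <;> cases l <;>
    simp only [edgeCoord, headCoord, edgeDir, edgeLeft, edgeLen, wingCoord, unitCoord_table,
      if_true, Bool.false_eq_true, if_false, Kind.cap, beq_self_eq_true, bne_self_eq_false,
      Bool.true_beq, Bool.false_beq, Bool.true_bne, Bool.false_bne, Bool.not_true, Bool.not_false]
      at q5 q6 h₂ ⊢ <;>
    (generalize φ = f at *) <;> linarith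
  · apply mem_region_of_nonneg <;> cases K <;> cases l <;>
    simp only [edgeCoord, headCoord, edgeDir, edgeLeft, edgeLen, wingCoord, unitCoord_table,
      if_true, Bool.false_eq_true, if_false, Kind.cap, beq_self_eq_true, bne_self_eq_false,
      Bool.true_beq, Bool.false_beq, Bool.true_bne, Bool.false_bne, Bool.not_true, Bool.not_false]
      at q5 q6 h₂ ⊢ <;>
    (generalize φ = f at *) <;> linarith

/-! ### Adjacent tiles -/

section
lemma norm_zeta : ‖zeta‖ = 1 := Complex.norm_exp_ofReal_mul_I _

lemma norm_unit (n : ZMod 10) : ‖unit n‖ = 1 := by rw [unit, norm_pow, norm_zeta, one_pow]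

lemma unit_ne_zero (n : ZMod 10) : unit n ≠ 0 := by
  rw [← norm_ne_zero_iff, norm_unit]; exact one_ne_zero

lemma unit_add_five (n : ZMod 10) : unit (n + 5) = -unit n := by
  rw [unit_add, unit_eq_pt 5]
  have : pt (unitCoord 5).1 (unitCoord 5).2 = -1 := by
    rw [one_eq_pt, pt_neg]; simp only [unitCoord_table]; simp
  rw [this]; ring

lemma Tile.norm_edgeVec (T : Tile) (k : Edge) : ‖T.edgeVec k‖ = 1 := by
  rw [edgeVec, norm_mul, norm_unit, Circle.norm_coe, one_mul]

lemma edgeLen_pos (k : Edge) : 0 < edgeLen k := by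
  unfold edgeLen; split_ifs <;> linarith [phi_gt]

lemma edgeLen_ge_one (k : Edge) : 1 ≤ edgeLen k := by
  unfold edgeLen; split_ifs <;> linarith [phi_gt]

lemma fst_eq_of_edgeLen {k k' : Edge} (h : edgeLen k = edgeLen k') : k.1 = k'.1 := by
  have := phi_gt
  obtain ⟨l, s⟩ := k
  obtain ⟨l', s'⟩ := k'
  cases l <;> cases l' <;> simp only [edgeLen, if_true, Bool.false_eq_true, if_false] at h ⊢ <;>
    linarith

lemma edgeLen_congr {k k' : Edge} (h : k.1 = k'.1) : edgeLen k = edgeLen k' := by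
  unfold edgeLen; rw [h]

/-- The tiles lie on different sides of a common edge. -/
structure Adj (T : Tile) (k : Edge) (T' : Tile) (k' : Edge) : Prop where
  long : k'.1 = k.1
  left : edgeLeft T'.kind k' ≠ edgeLeft T.kind k
  head : T'.head k' = T.head k
  vec : T'.edgeVec k' = T.edgeVec k

lemma isOpen_strip (l : ℝ) :
    IsOpen ({p : ℝ × ℝ | 4 * |p.2| < p.1} ∩ {p : ℝ × ℝ | 4 * |p.2| < l - p.1}) :=
  (isOpen_lt (by fun_prop) (by fun_prop)).inter (isOpen_lt (by fun_prop) (by fun_prop))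

/-- The witness depends only on the end `H`, the direction and the side of the edge. So two tiles
that agree in these have a common interior point. -/
lemma Tile.interior_of_edge (T : Tile) (k : Edge) :
    T.head k + T.edgeVec k * pt (1 / 2) (if edgeLeft T.kind k then 1 / 16 else -1 / 16)
      ∈ interior T.region := by
  have hl := edgeLen_ge_one k
  have strip := fun t y => T.edge_strip k (t := t) (y := y)
  by_cases h : edgeLeft T.kind k
  · simp only [h, if_true] at strip ⊢
    refine mem_nhds_of_coord (T.norm_edgeVec k) _
      (U := ({p | 4 * |p.2| < p.1} ∩ {p | 4 * |p.2| < edgeLen k - p.1}) ∩ {p | 0 < p.2})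
      ((isOpen_strip _).inter (isOpen_lt (by fun_prop) (by fun_prop))) ?_ ?_
    · rintro ⟨x, y⟩ ⟨⟨h₁, h₂⟩, h₃⟩
      simp only [Set.mem_ofPred_eq] at h₁ h₂ h₃
      rw [abs_of_pos h₃] at h₁ h₂
      exact strip _ _ h₃.le h₁.le h₂.le
    · refine ⟨⟨?_, ?_⟩, ?_⟩ <;> norm_num [abs_of_pos]; linarith
  · simp only [h] at strip ⊢
    refine mem_nhds_of_coord (T.norm_edgeVec k) _
      (U := ({p | 4 * |p.2| < p.1} ∩ {p | 4 * |p.2| < edgeLen k - p.1}) ∩ {p | p.2 < 0})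
      ((isOpen_strip _).inter (isOpen_lt (by fun_prop) (by fun_prop))) ?_ ?_
    · rintro ⟨x, y⟩ ⟨⟨h₁, h₂⟩, h₃⟩
      simp only [Set.mem_ofPred_eq] at h₁ h₂ h₃
      rw [abs_of_neg h₃] at h₁ h₂
      simpa using strip x (-y) (by linarith : 0 ≤ -y) h₁.le h₂.le
    · refine ⟨⟨?_, ?_⟩, ?_⟩ <;> norm_num [abs_of_neg]; linarith

/-- The flat triangles of `Tile.edge_strip` on the two sides of the edge together form a
neighbourhood of each of its inner points. -/
lemma Adj.mem_interior_union {T T' : Tile} {k k' : Edge} (h : Adj T k T' k') {t : ℝ}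
    (ht : 0 < t) (ht' : t < edgeLen k) :
    T.head k + T.edgeVec k * (t : ℂ) ∈ interior (T.region ∪ T'.region) := by
  rw [ofReal_eq_pt]
  refine mem_nhds_of_coord (T.norm_edgeVec k) _ (isOpen_strip (edgeLen k)) ?_ ?_
  · rintro ⟨x, y⟩ ⟨h₁, h₂⟩
    have s := T.edge_strip k (abs_nonneg y) h₁.le h₂.le
    have s' := T'.edge_strip k' (abs_nonneg y) h₁.le (by rw [edgeLen_congr h.long]; exact h₂.le)
    rw [h.head, h.vec] at s'
    have hl := h.left
    rcases abs_choice y with hy | hy <;> rw [hy] at s s' <;>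
      cases hk : edgeLeft T.kind k <;> cases hk' : edgeLeft T'.kind k' <;>
      simp_all
  · simp only [Set.mem_inter_iff, Set.mem_ofPred_eq, abs_zero, mul_zero]
    exact ⟨ht, by linarith⟩

lemma Tile.convexHull_interior_nonempty (T : Tile) :
    (interior (convexHull ℝ {T.apex, T.wingL, T.opp})).Nonempty ∧
      (interior (convexHull ℝ {T.apex, T.wingR, T.opp})).Nonempty := by
  have key : ∀ s : ℝ, s ^ 2 = 1 → (interior (convexHull ℝ
      {T.point 0 0, T.point ((φ + 1) / 2) (s * (φ / 2)), T.point T.kind.axis 0})).Nonempty := by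
    intro s hs
    have g := phi_gt
    have g' := phi_lt
    refine ⟨T.point (1 / 2) (s * (1 / 8)), mem_nhds_of_coord (Circle.norm_coe T.dir) T.apex
      (U := {p | 0 < s * p.2} ∩ {p | φ * (s * p.2) < p.1} ∩ {p | p.1 + (2 - φ) * (s * p.2) < 1})
      ?_ ?_ ?_⟩
    · refine IsOpen.inter (IsOpen.inter ?_ ?_) ?_ <;>
        exact isOpen_lt (by fun_prop) (by fun_prop)
    · rintro ⟨x, y⟩ ⟨⟨h₁, h₂⟩, h₃⟩
      simp only [Set.mem_ofPred_eq] at h₁ h₂ h₃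
      have := T.point_mem_hull h₁.le h₂.le ?_ s
      · rwa [← mul_assoc, ← pow_two, hs, one_mul] at this
      · generalize s * y = y at *
        cases T.kind <;> simp only [Kind.cap] <;> nlinarith
    · simp only [Set.mem_inter_iff, Set.mem_ofPred_eq, ← mul_assoc s, ← pow_two, hs]
      norm_num
      constructor <;> linarith
  rw [apex_eq, wingL_eq, wingR_eq, opp_eq]
  refine ⟨by simpa using key 1 (by norm_num), by simpa [neg_div] using key (-1) (by norm_num)⟩

lemma Tile.isClosed_hulls (T : Tile) :
    IsClosed (convexHull ℝ {T.apex, T.wingL, T.opp}) ∧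
      IsClosed (convexHull ℝ {T.apex, T.wingR, T.opp}) := by
  constructor <;> refine (Set.Finite.isCompact_convexHull (𝕜 := ℝ) ?_).isClosed <;>
    exact Set.toFinite _

lemma Tile.region_subset_closure (T : Tile) : T.region ⊆ closure (interior T.region) := by
  obtain ⟨h₁, h₂⟩ := T.convexHull_interior_nonempty
  rintro z (hz | hz)
  · refine closure_mono (interior_mono Set.subset_union_left) ?_
    rw [(convex_convexHull ℝ _).closure_interior_eq_closure_of_nonempty_interior h₁]
    exact subset_closure hz
  · refine closure_mono (interior_mono Set.subset_union_right) ?_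
    rw [(convex_convexHull ℝ _).closure_interior_eq_closure_of_nonempty_interior h₂]
    exact subset_closure hz

variable {τ : Set Tile}

lemma IsPenroseTiling.eq_of_interior (hτ : IsPenroseTiling τ) {T T' : Tile} (hT : T ∈ τ)
    (hT' : T' ∈ τ) {z : ℂ} (h : z ∈ interior T.region) (h' : z ∈ interior T'.region) : T = T' :=
  hτ.disjoint_interiors.elim_set hT hT' z h h'

/-- Near `z` the tiles `A` and `B` leave no room. Since a region is contained in the closure of its
interior, the interior of `S` meets that of `A` or of `B`. -/
lemma IsPenroseTiling.eq_or_eq (hτ : IsPenroseTiling τ) {A B S : Tile} (hA : A ∈ τ) (hB : B ∈ τ)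
    (hS : S ∈ τ) {z : ℂ} (h : z ∈ interior (A.region ∪ B.region)) (hz : z ∈ S.region) :
    S = A ∨ S = B := by
  obtain ⟨x, hx, hxS⟩ := mem_closure_iff.1 (S.region_subset_closure hz) _ isOpen_interior h
  have hO : IsOpen (interior (A.region ∪ B.region) ∩ interior S.region) :=
    isOpen_interior.inter isOpen_interior
  rcases interior_subset hx with hx' | hx'
  · obtain ⟨y, hy, hyA⟩ := mem_closure_iff.1 (A.region_subset_closure hx') _ hO ⟨hx, hxS⟩
    exact Or.inl (hτ.eq_of_interior hS hA hy.2 hyA)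
  · obtain ⟨y, hy, hyB⟩ := mem_closure_iff.1 (B.region_subset_closure hx') _ hO ⟨hx, hxS⟩
    exact Or.inr (hτ.eq_of_interior hS hB hy.2 hyB)

/-- A tile is determined by an edge and the side of the edge on which it lies. -/
lemma IsPenroseTiling.eq_of_edge (hτ : IsPenroseTiling τ) {T T' : Tile} (hT : T ∈ τ)
    (hT' : T' ∈ τ) {k k' : Edge} (hl : edgeLeft T'.kind k' = edgeLeft T.kind k)
    (hh : T'.head k' = T.head k) (hv : T'.edgeVec k' = T.edgeVec k) : T' = T := by
  have h := T.interior_of_edge k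
  have h' := T'.interior_of_edge k'
  rw [hl, hh, hv] at h'
  exact hτ.eq_of_interior hT' hT h' h

/-- The matching rule gives a second tile with the same ends in the same order, hence with the same
length and direction of the edge. On the same side it would coincide with `T`. -/
lemma IsPenroseTiling.exists_adj (hτ : IsPenroseTiling τ) {T : Tile} (hT : T ∈ τ) (k : Edge) :
    ∃ T' ∈ τ, ∃ k', Adj T k T' k' := by
  obtain ⟨T', hT', hne, he⟩ := hτ.matching T hT _ ((T.mem_edges_iff _).2 ⟨k, rfl⟩)
  obtain ⟨k', hk'⟩ := (T'.mem_edges_iff _).1 he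
  have h₁ : T'.head k' = T.head k := (congrArg Prod.fst hk').symm
  have h₂ : T'.tail k' = T.tail k := (congrArg Prod.snd hk').symm
  rw [Tile.tail_eq, Tile.tail_eq, h₁, add_right_inj] at h₂
  have h₃ : edgeLen k' = edgeLen k := by
    have := congrArg norm h₂
    rwa [norm_mul, norm_mul, Tile.norm_edgeVec, Tile.norm_edgeVec, one_mul, one_mul,
      Complex.norm_of_nonneg (edgeLen_pos _).le, Complex.norm_of_nonneg (edgeLen_pos _).le] at this
  rw [h₃] at h₂
  have h₄ := mul_right_cancel₀ (Complex.ofReal_ne_zero.2 (edgeLen_pos k).ne') h₂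
  exact ⟨T', hT', k', fst_eq_of_edgeLen h₃, fun h => hne (hτ.eq_of_edge hT hT' h h₁ h₄), h₁, h₄⟩

end

/-! ### Ammann bars -/

/-- The edge through which the Ammann bar with the direction `(zeta - zeta⁻¹) * zeta ^ n` leaves a
tile; the second component says whether it is perpendicular to the edge. -/
def exitEdge : Kind → ZMod 10 → Edge × Bool
  | .kite => ![((true, true), false), ((true, true), true), ((true, true), false),
      ((true, false), false), ((true, false), true), ((true, false), false),
      ((false, false), false), ((false, true), false), ((false, false), false),
      ((false, true), false)]
  | .dart => ![((true, true), false), ((true, true), true), ((true, true), false),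
      ((true, false), false), ((true, false), true), ((true, false), false),
      ((false, true), false), ((false, false), false), ((false, true), false),
      ((false, false), false)]

/-- The distance from the end labelled `H` at which an Ammann bar crosses an edge. -/
def crossing (perp : Bool) : ℝ := if perp then (3 * φ - 1) / 4 else (2 - φ) / 2

/-- The length of an Ammann bar in a tile, divided by `|zeta - zeta⁻¹|`, times `4`, as a pair
`(a, b)` that stands for `a + b φ`. -/
def barCoeff : Kind → ZMod 10 → ℤ × ℤ
  | .kite => ![(-4, 6), (0, 3), (4, -2), (4, -2), (0, 3), (-4, 6), (0, 3), (4, -2), (4, -2), (0, 3)]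
  | .dart => ![(4, -2), (0, 1), (0, 2), (0, 2), (0, 1), (4, -2), (0, 1), (0, 2), (0, 2), (0, 1)]

/-- The length of an Ammann bar in a tile, divided by `|zeta - zeta⁻¹|`. -/
def barLen (K : Kind) (n : ZMod 10) : ℝ := ((barCoeff K n).1 + (barCoeff K n).2 * φ) / 4

/-- The end of the Ammann bar with the given direction. -/
def Tile.exit (T : Tile) (n : ZMod 10) : ℂ :=
  T.head (exitEdge T.kind n).1 +
    T.edgeVec (exitEdge T.kind n).1 * (crossing (exitEdge T.kind n).2 : ℂ)

/-- The direction of the Ammann bars. -/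
def Tile.barVec (T : Tile) (n : ZMod 10) : ℂ := pt 0 1 * (T.dir * unit n)

lemma exitEdge_kite :
    exitEdge .kite 0 = ((true, true), false) ∧ exitEdge .kite 1 = ((true, true), true) ∧
    exitEdge .kite 2 = ((true, true), false) ∧ exitEdge .kite 3 = ((true, false), false) ∧
    exitEdge .kite 4 = ((true, false), true) ∧ exitEdge .kite 5 = ((true, false), false) ∧
    exitEdge .kite 6 = ((false, false), false) ∧ exitEdge .kite 7 = ((false, true), false) ∧
    exitEdge .kite 8 = ((false, false), false) ∧ exitEdge .kite 9 = ((false, true), false) :=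
  ⟨rfl, rfl, rfl, rfl, rfl, rfl, rfl, rfl, rfl, rfl⟩

lemma exitEdge_dart :
    exitEdge .dart 0 = ((true, true), false) ∧ exitEdge .dart 1 = ((true, true), true) ∧
    exitEdge .dart 2 = ((true, true), false) ∧ exitEdge .dart 3 = ((true, false), false) ∧
    exitEdge .dart 4 = ((true, false), true) ∧ exitEdge .dart 5 = ((true, false), false) ∧
    exitEdge .dart 6 = ((false, true), false) ∧ exitEdge .dart 7 = ((false, false), false) ∧
    exitEdge .dart 8 = ((false, true), false) ∧ exitEdge .dart 9 = ((false, false), false) :=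
  ⟨rfl, rfl, rfl, rfl, rfl, rfl, rfl, rfl, rfl, rfl⟩

lemma barCoeff_kite :
    barCoeff .kite 0 = (-4, 6) ∧ barCoeff .kite 1 = (0, 3) ∧ barCoeff .kite 2 = (4, -2) ∧
    barCoeff .kite 3 = (4, -2) ∧ barCoeff .kite 4 = (0, 3) ∧ barCoeff .kite 5 = (-4, 6) ∧
    barCoeff .kite 6 = (0, 3) ∧ barCoeff .kite 7 = (4, -2) ∧ barCoeff .kite 8 = (4, -2) ∧
    barCoeff .kite 9 = (0, 3) :=
  ⟨rfl, rfl, rfl, rfl, rfl, rfl, rfl, rfl, rfl, rfl⟩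

lemma barCoeff_dart :
    barCoeff .dart 0 = (4, -2) ∧ barCoeff .dart 1 = (0, 1) ∧ barCoeff .dart 2 = (0, 2) ∧
    barCoeff .dart 3 = (0, 2) ∧ barCoeff .dart 4 = (0, 1) ∧ barCoeff .dart 5 = (4, -2) ∧
    barCoeff .dart 6 = (0, 1) ∧ barCoeff .dart 7 = (0, 2) ∧ barCoeff .dart 8 = (0, 2) ∧
    barCoeff .dart 9 = (0, 1) :=
  ⟨rfl, rfl, rfl, rfl, rfl, rfl, rfl, rfl, rfl, rfl⟩

/-- The coordinates of the end of an Ammann bar. -/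
def exitCoord (K : Kind) (n : ZMod 10) : ℝ × ℝ :=
  edgeCoord K (exitEdge K n).1 (crossing (exitEdge K n).2) 0

lemma Tile.exit_eq (T : Tile) (n : ZMod 10) :
    T.exit n = T.point (exitCoord T.kind n).1 (exitCoord T.kind n).2 := by
  rw [exit, ofReal_eq_pt, head_add, exitCoord]

/-- The coordinates of the points of an Ammann bar. -/
def barCoord (K : Kind) (n : ZMod 10) (x : ℝ) : ℝ × ℝ :=
  ((exitCoord K (n + 5)).1 + (φ - 3) * (unitCoord n).2 * x,
    (exitCoord K (n + 5)).2 + (unitCoord n).1 * x)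

lemma Tile.exit_add (T : Tile) (n : ZMod 10) (x : ℝ) :
    T.exit (n + 5) + T.barVec n * (x : ℂ)
      = T.point (barCoord T.kind n x).1 (barCoord T.kind n x).2 := by
  rw [exit_eq, barVec, point, point, barCoord, unit_eq_pt, mul_left_comm, mul_assoc, add_assoc,
    ← mul_add, ofReal_eq_pt, pt_mul, pt_mul, pt_add]
  congr 2
  apply pt_congr <;> ring

/-- Consistency of the tables: travelling the tabulated length from one end of a bar leads to the
other end. -/
lemma barCoord_barLen (K : Kind) : ∀ n, barCoord K n (barLen K n) = exitCoord K n := by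
  have p := phi_sq
  have p3 : φ ^ 3 = 2 * φ + 1 := by rw [pow_succ, p]; linear_combination p
  cases K <;> refine forall_zmod ⟨?_, ?_, ?_, ?_, ?_, ?_, ?_, ?_, ?_, ?_⟩ <;> unfold barCoord <;>
    reduce_mod_char <;>
    simp only [exitCoord, barLen, exitEdge_kite, exitEdge_dart, barCoeff_kite, barCoeff_dart,
      edgeCoord, headCoord, wingCoord, edgeDir, unitCoord_table, crossing, if_true,
      Bool.false_eq_true, if_false] <;>
    (generalize φ = f at *) <;> apply Prod.ext <;> push_cast <;> ring_nf <;>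
    (try simp only [p3, p]) <;> ring

lemma Tile.exit_eq_add (T : Tile) (n : ZMod 10) :
    T.exit n = T.exit (n + 5) + T.barVec n * (barLen T.kind n : ℂ) := by
  rw [exit_add, barCoord_barLen, exit_eq]

lemma barLen_ge (K : Kind) : ∀ n, (1 / 10 : ℝ) ≤ barLen K n := by
  have g := phi_gt
  have g' := phi_lt
  cases K <;> refine forall_zmod ⟨?_, ?_, ?_, ?_, ?_, ?_, ?_, ?_, ?_, ?_⟩ <;>
    simp only [barLen, barCoeff_kite, barCoeff_dart] <;> push_cast <;>
    (generalize φ = f at *) <;> linarith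

lemma crossing_pos (b : Bool) : 0 < crossing b := by
  have g := phi_gt
  have g' := phi_lt
  unfold crossing; split_ifs <;> linarith

lemma crossing_lt (K : Kind) :
    ∀ n, crossing (exitEdge K n).2 < edgeLen (exitEdge K n).1 := by
  have g := phi_gt
  have g' := phi_lt
  cases K <;> refine forall_zmod ⟨?_, ?_, ?_, ?_, ?_, ?_, ?_, ?_, ?_, ?_⟩ <;>
    simp only [crossing, edgeLen, exitEdge_kite, exitEdge_dart, if_true,
      Bool.false_eq_true, if_false] <;> linarith

lemma Tile.exit_mem_region (T : Tile) (n : ZMod 10) : T.exit n ∈ T.region := by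
  have h₁ := crossing_pos (exitEdge T.kind n).2
  have h₂ := crossing_lt T.kind n
  have := T.edge_strip (exitEdge T.kind n).1 (t := crossing (exitEdge T.kind n).2) le_rfl
    (by linarith) (by linarith)
  rw [neg_zero, ite_self] at this
  rwa [exit, ofReal_eq_pt]

/-- A finite check that bars match across edges. Subtracting one edge direction and adding the other
translates `n` into the frame of the neighbour; the 5 reverses it, because the bar followed
backwards leaves the neighbour through the common edge. -/
lemma exitEdge_continue (K K' : Kind) : ∀ (n : ZMod 10) (k : Edge),
    k.1 = (exitEdge K n).1.1 → edgeLeft K' k ≠ edgeLeft K (exitEdge K n).1 →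
    exitEdge K' (n - edgeDir K (exitEdge K n).1 + edgeDir K' k + 5) = (k, (exitEdge K n).2) := by
  cases K <;> cases K' <;> decide

/-- Ammann bars continue across edges. -/
lemma Adj.exit_eq {T T' : Tile} {n : ZMod 10} {k' : Edge}
    (h : Adj T (exitEdge T.kind n).1 T' k') :
    ∃ n', T'.exit (n' + 5) = T.exit n ∧ T'.barVec n' = T.barVec n := by
  have hc := exitEdge_continue T.kind T'.kind n k' h.long h.left
  refine ⟨n - edgeDir T.kind (exitEdge T.kind n).1 + edgeDir T'.kind k', ?_, ?_⟩
  · rw [Tile.exit, hc, h.head, h.vec, Tile.exit]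
  · have hv := h.vec
    rw [Tile.edgeVec, Tile.edgeVec] at hv
    rw [Tile.barVec, Tile.barVec]
    congr 1
    rw [unit_add, mul_left_comm, hv, mul_left_comm, ← unit_add, sub_add_cancel]

/-- Bars meet the boundary only at their ends. This is what confines the tiles through a point of a
bar to a tile and one neighbour. -/
lemma Tile.barCoord_mem_interior_kite {T : Tile} (hT : T.kind = .kite) : ∀ (n : ZMod 10) (x : ℝ),
    0 < x → x < barLen .kite n →
    T.point (barCoord .kite n x).1 (barCoord .kite n x).2 ∈ interior T.region := by
  have g := phi_gt
  have g' := phi_lt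
  have p := phi_sq
  have p3 : φ ^ 3 = 2 * φ + 1 := by rw [pow_succ, p]; linear_combination p
  refine forall_zmod ⟨?_, ?_, ?_, ?_, ?_, ?_, ?_, ?_, ?_, ?_⟩ <;> intro x h₁ h₂ <;>
    have q1 := mul_nonneg (sub_nonneg.2 g.le) h₁.le <;>
    have q2 := mul_nonneg (sub_nonneg.2 g'.le) h₁.le <;>
    have q3 := mul_nonneg (sub_nonneg.2 g.le) (sub_nonneg.2 h₂.le) <;>
    have q4 := mul_nonneg (sub_nonneg.2 g'.le) (sub_nonneg.2 h₂.le) <;>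
    apply mem_interior_kite hT <;> unfold barCoord <;>
    reduce_mod_char <;>
    simp only [exitCoord, barLen, exitEdge_kite, barCoeff_kite,
      edgeCoord, headCoord, wingCoord, edgeDir, unitCoord_table, crossing, if_true,
      Bool.false_eq_true, if_false] at h₂ q3 q4 ⊢ <;> push_cast at h₂ q3 q4 <;>
    (generalize φ = f at *) <;>
    ring_nf at h₁ h₂ q1 q2 q3 q4 ⊢ <;> (try simp only [p3, p] at h₂ q1 q2 q3 q4 ⊢) <;> linarith

section
lemma Tile.barCoord_mem_interior_dart {T : Tile} (hT : T.kind = .dart) : ∀ (n : ZMod 10) (x : ℝ),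
    0 < x → x < barLen .dart n →
    T.point (barCoord .dart n x).1 (barCoord .dart n x).2 ∈ interior T.region := by
  have g := phi_gt
  have g' := phi_lt
  have p := phi_sq
  have p3 : φ ^ 3 = 2 * φ + 1 := by rw [pow_succ, p]; linear_combination p
  -- The dart is not convex: at the reflex vertex it is a union of two half-planes. For each bar,
  -- one of the two alternatives holds along the whole bar.
  have key : ∀ (n : ZMod 10) (x : ℝ), 0 < x → x < barLen .dart n →
      φ * (barCoord .dart n x).2 < (barCoord .dart n x).1 ∧
      -φ * (barCoord .dart n x).2 < (barCoord .dart n x).1 ∧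
      ((barCoord .dart n x).1 - (2 - φ) * (barCoord .dart n x).2 < 1 ∨
       (barCoord .dart n x).1 + (2 - φ) * (barCoord .dart n x).2 < 1) := by
    refine forall_zmod ⟨?_, ?_, ?_, ?_, ?_, ?_, ?_, ?_, ?_, ?_⟩ <;> intro x h₁ h₂ <;>
      have q1 := mul_nonneg (sub_nonneg.2 g.le) h₁.le <;>
      have q2 := mul_nonneg (sub_nonneg.2 g'.le) h₁.le <;>
      have q3 := mul_nonneg (sub_nonneg.2 g.le) (sub_nonneg.2 h₂.le) <;>
      have q4 := mul_nonneg (sub_nonneg.2 g'.le) (sub_nonneg.2 h₂.le) <;>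
      unfold barCoord <;> reduce_mod_char <;>
      simp only [exitCoord, barLen, exitEdge_dart, barCoeff_dart,
        edgeCoord, headCoord, edgeDir, unitCoord_table, crossing, if_true,
        Bool.false_eq_true, if_false] at h₂ q3 q4 ⊢ <;> push_cast at h₂ q3 q4 <;>
      (generalize φ = f at *) <;>
      ring_nf at h₁ h₂ q1 q2 q3 q4 ⊢ <;> (try simp only [p3, p] at h₂ q1 q2 q3 q4 ⊢) <;>
      refine ⟨by linarith, by linarith, ?_⟩ <;>
      first | (left; linarith) | (right; linarith)
  intro n x h₁ h₂
  obtain ⟨a, b, c⟩ := key n x h₁ h₂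
  refine mem_interior_dart hT a b ?_
  have u := le_abs_self (barCoord .dart n x).2
  have v := neg_le_abs (barCoord .dart n x).2
  rcases c with c | c <;> nlinarith

lemma Tile.bar_mem_interior (T : Tile) (n : ZMod 10) {x : ℝ} (h₁ : 0 < x)
    (h₂ : x < barLen T.kind n) : T.exit (n + 5) + T.barVec n * (x : ℂ) ∈ interior T.region := by
  rw [exit_add]
  rcases hT : T.kind with _ | _
  · rw [hT] at h₂; exact barCoord_mem_interior_kite hT n x h₁ h₂
  · rw [hT] at h₂; exact barCoord_mem_interior_dart hT n x h₁ h₂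

lemma Tile.bar_cases (T : Tile) (n : ZMod 10) {x : ℝ} (h₁ : 0 ≤ x)
    (h₂ : x ≤ barLen T.kind n) :
    T.exit (n + 5) + T.barVec n * (x : ℂ) ∈ interior T.region ∨
      ∃ m, T.exit (n + 5) + T.barVec n * (x : ℂ) = T.exit m := by
  rcases h₁.eq_or_lt with rfl | h₁
  · right; exact ⟨n + 5, by simp⟩
  rcases h₂.eq_or_lt with rfl | h₂
  · right; exact ⟨n, (T.exit_eq_add n).symm⟩
  · left; exact T.bar_mem_interior n h₁ h₂

lemma Tile.bar_mem_region (T : Tile) (n : ZMod 10) {x : ℝ} (h₁ : 0 ≤ x)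
    (h₂ : x ≤ barLen T.kind n) : T.exit (n + 5) + T.barVec n * (x : ℂ) ∈ T.region := by
  rcases T.bar_cases n h₁ h₂ with h | ⟨m, h⟩
  · exact interior_subset h
  · rw [h]; exact T.exit_mem_region m

variable {τ : Set Tile}

/-- A tile that contains a point of an Ammann bar of another tile is a neighbour of it. -/
lemma IsPenroseTiling.eq_or_adj (hτ : IsPenroseTiling τ) {T T' : Tile} (hT : T ∈ τ)
    (hT' : T' ∈ τ) {n : ZMod 10} {x : ℝ} (h₁ : 0 ≤ x) (h₂ : x ≤ barLen T.kind n)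
    (h : T.exit (n + 5) + T.barVec n * (x : ℂ) ∈ T'.region) :
    T' = T ∨ ∃ k k', Adj T k T' k' := by
  rcases T.bar_cases n h₁ h₂ with hz | ⟨m, hm⟩
  · left
    have := hτ.eq_or_eq (A := T) (B := T) hT hT hT' (by rwa [Set.union_self]) h
    tauto
  · obtain ⟨V, hV, k', ha⟩ := hτ.exists_adj hT (exitEdge T.kind m).1
    have hi := ha.mem_interior_union (crossing_pos _) (crossing_lt T.kind m)
    rw [hm] at h
    rcases hτ.eq_or_eq hT hV hT' hi h with rfl | rfl
    · exact Or.inl rfl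
    · exact Or.inr ⟨_, _, ha⟩

lemma Adj.exists_dir {T T' : Tile} {k k' : Edge} (h : Adj T k T' k') :
    ∃ j, (T'.dir : ℂ) = T.dir * unit j := by
  refine ⟨edgeDir T.kind k - edgeDir T'.kind k', ?_⟩
  apply mul_right_cancel₀ (unit_ne_zero (edgeDir T'.kind k'))
  rw [mul_assoc, ← unit_add, sub_add_cancel]
  exact h.vec

/-! ### A Galois conjugation of the plane -/

/-- An additive map of the plane that is semilinear with respect to the automorphism
`zeta ↦ zeta ^ 3` of the tenth cyclotomic field. -/
structure IsConj (S : ℂ →+ ℂ) : Prop where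
  map_zeta_mul (z : ℂ) : S (zeta * z) = zeta ^ 3 * S z

lemma isPrimitiveRoot_zeta : IsPrimitiveRoot zeta 10 := by
  have := Complex.isPrimitiveRoot_exp 10 (by norm_num)
  convert this using 1
  unfold zeta
  congr 1
  push_cast; ring

/-- `zeta ^ 3` is a root of the minimal polynomial of `zeta`, which gives an embedding of ℚ(zeta)
into ℂ. It is composed with a ℚ(zeta)-linear functional on ℂ with value 1 at `u`. Since the map is
defined on all of ℂ, the vertices need not lie in a chosen lattice. -/
lemma exists_isConj {u : ℂ} (hu : u ≠ 0) : ∃ S : ℂ →+ ℂ, IsConj S ∧ S u = 1 := by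
  have hp := isPrimitiveRoot_zeta
  have hint : IsIntegral ℚ zeta := (hp.isIntegral (by norm_num)).tower_top
  have hroot : Polynomial.aeval (zeta ^ 3) (minpoly ℚ zeta) = 0 := by
    have h3 : IsPrimitiveRoot (zeta ^ 3) 10 := hp.pow_of_coprime 3 (by norm_num)
    rw [← Polynomial.cyclotomic_eq_minpoly_rat hp (by norm_num),
      Polynomial.cyclotomic_eq_minpoly_rat h3 (by norm_num)]
    exact minpoly.aeval _ _
  let pb := IntermediateField.adjoin.powerBasis hint
  have hgen : algebraMap _ ℂ pb.gen = zeta := by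
    simp [pb]
  have hmin : minpoly ℚ pb.gen = minpoly ℚ zeta := by
    have := minpoly.algebraMap_eq (A := ℚ)
      (algebraMap (IntermediateField.adjoin ℚ {zeta}) ℂ).injective pb.gen
    exact this.symm.trans (congrArg (minpoly ℚ) hgen)
  let σ := pb.lift (zeta ^ 3) (hmin ▸ hroot)
  have hσ : σ pb.gen = zeta ^ 3 := pb.lift_gen _ _
  obtain ⟨L, hL⟩ := Module.Projective.exists_dual_eq_one (IntermediateField.adjoin ℚ {zeta}) hu
  refine ⟨σ.toRingHom.toAddMonoidHom.comp L.toAddMonoidHom, ⟨fun z => ?_⟩, ?_⟩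
  · have : zeta * z = pb.gen • z := congrArg (· * z) hgen.symm
    change σ (L (zeta * z)) = zeta ^ 3 * σ (L z)
    rw [this, map_smul, smul_eq_mul, map_mul, hσ]
  · change σ (L u) = 1
    rw [hL, map_one]

end

section
lemma zeta_pow_eq_unit (n : ℕ) : zeta ^ n = unit n := by
  rw [zeta_pow, unit_eq_pt]

lemma unit_table (n : ZMod 10) (a b : ℝ) (h : unitCoord n = (a, b)) : unit n = pt a b := by
  rw [unit_eq_pt, h]

namespace IsConj

variable {S : ℂ →+ ℂ}

lemma map_unit_mul (h : IsConj S) (n : ZMod 10) (z : ℂ) : S (unit n * z) = unit (3 * n) * S z := by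
  have key : ∀ k : ℕ, S (zeta ^ k * z) = zeta ^ (3 * k) * S z := by
    intro k
    induction k with
    | zero => simp
    | succ k ih =>
      rw [pow_succ', mul_assoc, h.map_zeta_mul, ih, ← mul_assoc, ← pow_add]
      congr 2; ring
  rw [unit, key, zeta_pow_eq_unit]
  push_cast
  rw [ZMod.natCast_zmod_val]

lemma map_phi_mul (h : IsConj S) (z : ℂ) : S ((φ : ℂ) * z) = ((1 - φ : ℝ) : ℂ) * S z := by
  have e : (φ : ℂ) = unit 1 + unit 9 := by
    rw [unit_table 1 _ _ rfl, unit_table 9 _ _ rfl, pt_add, ofReal_eq_pt]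
    apply pt_congr <;> ring
  have e' : ((1 - φ : ℝ) : ℂ) = unit (3 * 1) + unit (3 * 9) := by
    rw [show (3 * 1 : ZMod 10) = 3 from rfl, show (3 * 9 : ZMod 10) = 7 from rfl,
      unit_table 3 _ _ rfl, unit_table 7 _ _ rfl, pt_add, ofReal_eq_pt]
    apply pt_congr <;> ring
  rw [e, add_mul, map_add, h.map_unit_mul, h.map_unit_mul, e', add_mul]

/-- `pt 0 1` is zeta - zeta⁻¹, and zeta³ - zeta⁻³ is φ times it. So a bar perpendicular to zeta^n
keeps a conjugate direction perpendicular to zeta^(3n). -/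
lemma map_pt_mul (h : IsConj S) (z : ℂ) : S (pt 0 1 * z) = pt 0 φ * S z := by
  have e : pt 0 1 = unit 1 - unit 9 := by
    rw [unit_table 1 _ _ rfl, unit_table 9 _ _ rfl, pt_sub]
    apply pt_congr <;> ring
  have e' : pt 0 φ = unit (3 * 1) - unit (3 * 9) := by
    rw [show (3 * 1 : ZMod 10) = 3 from rfl, show (3 * 9 : ZMod 10) = 7 from rfl,
      unit_table 3 _ _ rfl, unit_table 7 _ _ rfl, pt_sub]
    apply pt_congr <;> ring
  rw [e, sub_mul, map_sub, h.map_unit_mul, h.map_unit_mul, e', sub_mul]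

/-- Bar lengths lie in ℚ(φ), whose conjugates are real. Therefore the conjugates of the ends of
successive pieces stay on one line. -/
lemma map_barLen_mul (h : IsConj S) (K : Kind) (n : ZMod 10) (z : ℂ) :
    ∃ r : ℝ, S (z * (barLen K n : ℂ)) = (r : ℂ) * S z := by
  refine ⟨((barCoeff K n).1 + (barCoeff K n).2 * (1 - φ)) / 4, ?_⟩
  -- The denominator 4 is cleared first, so that additivity of `S` suffices.
  have h4 : (4 : ℂ) * S (z * (barLen K n : ℂ))
      = (((barCoeff K n).1 + (barCoeff K n).2 * (1 - φ) : ℝ) : ℂ) * S z := by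
    have : (4 : ℂ) * S (z * (barLen K n : ℂ)) = S ((4 : ℕ) • (z * (barLen K n : ℂ))) := by
      rw [map_nsmul, nsmul_eq_mul]; norm_num
    have e : (4 : ℕ) • (z * (barLen K n : ℂ))
        = (barCoeff K n).1 • z + (barCoeff K n).2 • ((φ : ℂ) * z) := by
      rw [barLen, nsmul_eq_mul, zsmul_eq_mul, zsmul_eq_mul]
      push_cast; ring
    rw [this, e, map_add, map_zsmul, map_zsmul, h.map_phi_mul, zsmul_eq_mul, zsmul_eq_mul]
    push_cast; ring
  rw [← mul_right_inj' (by norm_num : (4 : ℂ) ≠ 0), h4]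
  push_cast; ring

end IsConj

/-! ### Walking along Ammann bars -/

variable {τ : Set Tile} {S : ℂ →+ ℂ}

/-- The Ammann bar of a tile extends to a line in one direction, and the conjugates of the
ends of its pieces lie on a line as well. -/
lemma IsPenroseTiling.walk_pos (hτ : IsPenroseTiling τ) (hS : IsConj S) (N : ℕ) :
    ∀ T ∈ τ, ∀ (n : ZMod 10) (x : ℝ), 0 ≤ x → x ≤ N / 10 →
    ∃ V ∈ τ, ∃ (m : ZMod 10) (y : ℝ), 0 ≤ y ∧ y ≤ barLen V.kind m ∧
      V.exit (m + 5) + V.barVec m * (y : ℂ) = T.exit (n + 5) + T.barVec n * (x : ℂ) ∧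
      (∃ j, (V.dir : ℂ) = T.dir * unit j) ∧
      ∃ r : ℝ, S (V.exit (m + 5)) = S (T.exit (n + 5)) + (r : ℂ) * S (T.barVec n) := by
  induction N with
  | zero =>
    intro T hT n x h₁ h₂
    have : (0 : ℝ) ≤ barLen T.kind n := by linarith [barLen_ge T.kind n]
    have hx : x = 0 := le_antisymm (by simpa using h₂) h₁
    exact ⟨T, hT, n, x, h₁, by rw [hx]; exact this, rfl, ⟨0, by rw [unit_zero, mul_one]⟩, 0,
      by simp⟩
  | succ N ih =>
    intro T hT n x h₁ h₂
    rcases le_or_gt x (barLen T.kind n) with hx | hx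
    · exact ⟨T, hT, n, x, h₁, hx, rfl, ⟨0, by rw [unit_zero, mul_one]⟩, 0, by simp⟩
    obtain ⟨T', hT', k', ha⟩ := hτ.exists_adj hT (exitEdge T.kind n).1
    obtain ⟨n', he, hv⟩ := ha.exit_eq
    obtain ⟨j', hj'⟩ := ha.exists_dir
    -- Each piece has length at least 1/10, so leaving a tile uses up one step of the induction.
    have hb := barLen_ge T.kind n
    push_cast at h₂
    obtain ⟨V, hV, m, y, hy, hy', hz, ⟨j, hj⟩, r, hr⟩ :=
      ih T' hT' n' (x - barLen T.kind n) (by linarith) (by linarith)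
    obtain ⟨s, hs⟩ := hS.map_barLen_mul T.kind n (T.barVec n)
    refine ⟨V, hV, m, y, hy, hy', ?_, ⟨j' + j, by rw [hj, hj', unit_add, mul_assoc]⟩, s + r, ?_⟩
    · rw [hz, he, hv, T.exit_eq_add]; push_cast; ring
    · rw [hr, he, hv, T.exit_eq_add, map_add, hs]; push_cast; ring

lemma Tile.barVec_add_five (T : Tile) (n : ZMod 10) : T.barVec (n + 5) = -T.barVec n := by
  rw [barVec, barVec, unit_add_five]; ring

/-- The Ammann bars extend to lines, and the conjugates of the ends of the pieces of such a line
lie on a line as well. -/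
lemma IsPenroseTiling.walk (hτ : IsPenroseTiling τ) (hS : IsConj S) {T : Tile} (hT : T ∈ τ)
    (n : ZMod 10) (x : ℝ) :
    ∃ V ∈ τ, ∃ (m : ZMod 10) (y : ℝ), 0 ≤ y ∧ y ≤ barLen V.kind m ∧
      V.exit (m + 5) + V.barVec m * (y : ℂ) = T.exit (n + 5) + T.barVec n * (x : ℂ) ∧
      (∃ j, (V.dir : ℂ) = T.dir * unit j) ∧
      ∃ r : ℝ, S (V.exit (m + 5)) = S (T.exit (n + 5)) + (r : ℂ) * S (T.barVec n) := by
  rcases le_total 0 x with hx | hx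
  · obtain ⟨N, hN⟩ := exists_nat_ge (x * 10)
    exact hτ.walk_pos hS N T hT n x hx (by linarith)
  · obtain ⟨N, hN⟩ := exists_nat_ge ((barLen T.kind n - x) * 10)
    obtain ⟨V, hV, m, y, hy, hy', hz, hj, r, hr⟩ := hτ.walk_pos hS N T hT (n + 5)
      (barLen T.kind n - x) (by linarith [barLen_ge T.kind n]) (by linarith)
    obtain ⟨s, hs⟩ := hS.map_barLen_mul T.kind n (T.barVec n)
    have h10 : n + 5 + 5 = n := by
      rw [add_assoc, show (5 + 5 : ZMod 10) = 0 from rfl, add_zero]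
    rw [h10] at hz hr
    rw [T.barVec_add_five] at hz hr
    refine ⟨V, hV, m, y, hy, hy', ?_, hj, s - r, ?_⟩
    · rw [hz, T.exit_eq_add n]; push_cast; ring
    · rw [hr, T.exit_eq_add n, map_add, hs, map_neg]; push_cast; ring

lemma exists_real_combination {a b : ℂ} (h : ((starRingEnd ℂ a) * b).im ≠ 0) (z : ℂ) :
    ∃ x y : ℝ, z = a * x + b * y := by
  have h' : a.re * b.im - a.im * b.re ≠ 0 := by
    convert h using 1; simp; ring
  obtain ⟨x, hx⟩ : ∃ x, x * (a.re * b.im - a.im * b.re) = z.re * b.im - z.im * b.re :=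
    ⟨_, div_mul_cancel₀ _ h'⟩
  obtain ⟨y, hy⟩ : ∃ y, y * (a.re * b.im - a.im * b.re) = a.re * z.im - a.im * z.re :=
    ⟨_, div_mul_cancel₀ _ h'⟩
  refine ⟨x, y, ?_⟩
  apply Complex.ext <;> apply mul_right_cancel₀ h' <;>
    simp only [Complex.add_re, Complex.add_im, Complex.mul_re, Complex.mul_im, Complex.ofReal_re,
      Complex.ofReal_im]
  · linear_combination (-a.re) * hx - b.re * hy
  · linear_combination (-a.im) * hx - b.im * hy

/-- Two Ammann bars with different directions meet in a tile, up to passing to a neighbour. -/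
lemma IsPenroseTiling.cross (hτ : IsPenroseTiling τ) (hS : IsConj S) {T T' : Tile} (hT : T ∈ τ)
    (hT' : T' ∈ τ) {n n' : ZMod 10} (h : ((starRingEnd ℂ (T.barVec n)) * T'.barVec n').im ≠ 0) :
    ∃ V ∈ τ, ∃ V' ∈ τ, ∃ (z : ℂ) (x x' r r' : ℝ) (m m' : ZMod 10), z ∈ V.region ∧ z ∈ V'.region ∧
      (V' = V ∨ ∃ k k', Adj V k V' k') ∧
      (∃ j, (V.dir : ℂ) = T.dir * unit j) ∧ (∃ j, (V'.dir : ℂ) = T'.dir * unit j) ∧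
      z = T.exit (n + 5) + T.barVec n * (x : ℂ) ∧
      z = T'.exit (n' + 5) + T'.barVec n' * (x' : ℂ) ∧
      S (V.exit m) = S (T.exit (n + 5)) + (r : ℂ) * S (T.barVec n) ∧
      S (V'.exit m') = S (T'.exit (n' + 5)) + (r' : ℂ) * S (T'.barVec n') := by
  obtain ⟨x, y, hxy⟩ := exists_real_combination h (T'.exit (n' + 5) - T.exit (n + 5))
  have hz : T.exit (n + 5) + T.barVec n * (x : ℂ)
      = T'.exit (n' + 5) + T'.barVec n' * ((-y : ℝ) : ℂ) := by
    push_cast; linear_combination -hxy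
  obtain ⟨V, hV, m, w, hw, hw', e, hj, r, hr⟩ := hτ.walk hS hT n x
  obtain ⟨V', hV', m', v, hv, hv', e', hj', r', hr'⟩ := hτ.walk hS hT' n' (-y)
  have hm := V.bar_mem_region m hw hw'
  have hm' := V'.bar_mem_region m' hv hv'
  have hzz := e'.trans (hz.symm.trans e.symm)
  rw [hzz] at hm'
  refine ⟨V, hV, V', hV', _, x, -y, r, r', _, _, hm, hm', hτ.eq_or_adj hV hV' hw hw' hm', hj, hj',
    e, e.trans hz, hr, hr'⟩

/-- The directions of the tiles of a Penrose tiling differ by multiples of `36°`. -/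
lemma IsPenroseTiling.exists_dir (hτ : IsPenroseTiling τ) {T T' : Tile} (hT : T ∈ τ)
    (hT' : T' ∈ τ) : ∃ j, (T'.dir : ℂ) = T.dir * unit j := by
  obtain ⟨S, hS, -⟩ := exists_isConj (one_ne_zero (α := ℂ))
  have main : ∀ n n', ((starRingEnd ℂ (T.barVec n)) * T'.barVec n').im ≠ 0 →
      ∃ j, (T'.dir : ℂ) = T.dir * unit j := by
    intro n n' h
    obtain ⟨V, -, V', -, z, x, x', r, r', m, m', -, -, ha, ⟨j, hj⟩, ⟨j', hj'⟩, -⟩ :=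
      hτ.cross hS hT hT' h
    have : ∃ i, (V'.dir : ℂ) = V.dir * unit i := by
      rcases ha with rfl | ⟨k, k', ha⟩
      · exact ⟨0, by rw [unit_zero, mul_one]⟩
      · exact ha.exists_dir
    obtain ⟨i, hi⟩ := this
    refine ⟨j + i - j', mul_right_cancel₀ (unit_ne_zero j') ?_⟩
    rw [← hj', hi, hj, mul_assoc, mul_assoc, ← unit_add, ← unit_add, sub_add_cancel]
  -- Otherwise the bar 0 of `T'` would be parallel to the bars 0 and 1 of `T`, whose directions
  -- differ by 36°.
  by_contra hcon
  have h0 : ((starRingEnd ℂ (T.barVec 0)) * T'.barVec 0).im = 0 := by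
    by_contra h; exact hcon (main _ _ h)
  have h1 : ((starRingEnd ℂ (T.barVec 1)) * T'.barVec 0).im = 0 := by
    by_contra h; exact hcon (main _ _ h)
  have e1 : T.barVec 1 = zeta * T.barVec 0 := by
    rw [Tile.barVec, Tile.barVec, unit_one, unit_zero]; ring
  rw [e1, map_mul, mul_assoc] at h1
  set w := (starRingEnd ℂ (T.barVec 0)) * T'.barVec 0 with hw
  have hne : w ≠ 0 := by
    have hk : pt 0 1 ≠ 0 := by
      rw [← pt_zero]; intro h; exact one_ne_zero (pt_inj h).2
    have : ∀ V : Tile, V.barVec 0 ≠ 0 := fun V =>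
      mul_ne_zero hk (mul_ne_zero (Circle.coe_ne_zero _) (unit_ne_zero 0))
    exact mul_ne_zero ((map_ne_zero _).2 (this T)) (this T')
  have hc := chord_pos
  rw [Complex.mul_im, h0, zeta_eq_pt] at h1
  simp [pt, hc.ne'] at h1
  exact hne (Complex.ext h1 h0)

end

section
/-! ### Diameters and areas -/

lemma Tile.dist_point (T : Tile) (a b c d : ℝ) :
    dist (T.point a b) (T.point c d) ^ 2 = (a - c) ^ 2 + (3 - φ) * (b - d) ^ 2 := by
  rw [dist_eq_norm, point, point, add_sub_add_left_eq_sub, ← mul_sub, pt_sub, norm_mul,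
    Circle.norm_coe, one_mul, ← Complex.normSq_eq_norm_sq, Complex.normSq_apply, pt]
  simp only
  linear_combination (b - d) ^ 2 * chord_sq

lemma Tile.region_subset_hull (T : Tile) :
    T.region ⊆ convexHull ℝ {T.apex, T.wingL, T.wingR, T.opp} := by
  rintro z (hz | hz) <;> refine convexHull_mono ?_ hz <;>
    rintro x (rfl | rfl | rfl) <;> simp

lemma Tile.dist_le_two {T : Tile} {z w : ℂ} (hz : z ∈ T.region) (hw : w ∈ T.region) :
    dist z w ≤ 2 := by
  obtain ⟨x, hx, y, hy, h⟩ :=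
    convexHull_exists_dist_ge2 (T.region_subset_hull hz) (T.region_subset_hull hw)
  refine h.trans (abs_le_of_sq_le_sq' ?_ (by norm_num)).2
  have g := phi_gt
  have g' := phi_lt
  have p := phi_sq
  have hA : 0 ≤ T.kind.axis ∧ T.kind.axis ≤ 2 ∧ (T.kind.axis = φ ∨ T.kind.axis = 1) := by
    cases T.kind <;> simp only [Kind.axis] <;> refine ⟨by linarith, by linarith, by simp⟩
  simp only [apex_eq, wingL_eq, wingR_eq, opp_eq, Set.mem_insert_iff, Set.mem_singleton_iff]
    at hx hy
  rcases hx with rfl | rfl | rfl | rfl <;> rcases hy with rfl | rfl | rfl | rfl <;>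
    rw [dist_point] <;> rcases hA with ⟨h₁, h₂, h₃ | h₃⟩ <;> (try rw [h₃]) <;>
    (generalize φ = f at *) <;> nlinarith

lemma Tile.apex_mem_region (T : Tile) : T.apex ∈ T.region :=
  Or.inl (subset_convexHull ℝ _ (by simp))

/-- The area of a standard triangle. -/
def triangleArea : ℝ≥0∞ := volume (convexHull ℝ {(0 : ℂ), 1, Complex.I})

/-- The triangle is an affine image of the standard one. The area of the standard triangle enters
only as a common factor and is never evaluated. -/
lemma volume_triangle (a b c : ℂ) :
    volume (convexHull ℝ {a, a + b, a + c})
      = ENNReal.ofReal |b.re * c.im - b.im * c.re| * triangleArea := by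
  let L : ℂ →ₗ[ℝ] ℂ := Matrix.toLin Complex.basisOneI Complex.basisOneI !![b.re, c.re; b.im, c.im]
  have hdet : LinearMap.det L = b.re * c.im - b.im * c.re := by
    rw [LinearMap.det_toLin, Matrix.det_fin_two_of]; ring
  have h1 : L 1 = b := by
    have := Matrix.toLin_self Complex.basisOneI Complex.basisOneI
      !![b.re, c.re; b.im, c.im] 0
    simp [Complex.coe_basisOneI] at this
    change L 1 = _ at this
    rw [this]
  have hI : L Complex.I = c := by
    have := Matrix.toLin_self Complex.basisOneI Complex.basisOneI
      !![b.re, c.re; b.im, c.im] 1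
    simp [Complex.coe_basisOneI] at this
    change L Complex.I = _ at this
    rw [this]
  let f : ℂ →ᵃ[ℝ] ℂ := AffineMap.const ℝ ℂ a + L.toAffineMap
  have hf : ∀ z, f z = a + L z := fun z => rfl
  have himg : convexHull ℝ {a, a + b, a + c} =
      (fun z => a + z) '' (L '' convexHull ℝ {0, 1, Complex.I}) := by
    rw [Set.image_image]
    change _ = f '' _
    rw [AffineMap.image_convexHull]
    congr 1
    simp [Set.image_insert_eq, hf, h1, hI]
  rw [himg, Set.image_add_left, measure_preimage_add, Measure.addHaar_image_linearMap, hdet,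
    triangleArea]

lemma Tile.volume_halves (T : Tile) :
    volume (convexHull ℝ {T.apex, T.wingL, T.opp})
      = ENNReal.ofReal (T.kind.axis * (chord * (φ / 2))) * triangleArea ∧
    volume (convexHull ℝ {T.apex, T.wingR, T.opp})
      = ENNReal.ofReal (T.kind.axis * (chord * (φ / 2))) * triangleArea := by
  have hA : 0 ≤ T.kind.axis := by
    cases T.kind <;> simp only [Kind.axis] <;> linarith [phi_gt]
  have hc := chord_pos
  have hφ := phi_gt
  have key : ∀ s : ℝ, |s| = 1 → volume (convexHull ℝ {T.point 0 0,
      T.point ((φ + 1) / 2) (s * (φ / 2)), T.point T.kind.axis 0})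
      = ENNReal.ofReal (T.kind.axis * (chord * (φ / 2))) * triangleArea := by
    intro s hs
    rw [← apex_eq, point, point, volume_triangle]
    congr 2
    have hd : (T.dir : ℂ).re ^ 2 + (T.dir : ℂ).im ^ 2 = 1 := by
      have := Circle.normSq_coe T.dir
      rw [Complex.normSq_apply] at this
      linarith
    have : ∀ d : ℂ, d.re ^ 2 + d.im ^ 2 = 1 →
      (d * pt ((φ + 1) / 2) (s * (φ / 2))).re * (d * pt T.kind.axis 0).im
      - (d * pt ((φ + 1) / 2) (s * (φ / 2))).im * (d * pt T.kind.axis 0).re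
      = -s * (T.kind.axis * (chord * (φ / 2))) := by
      intro d hd
      simp only [pt, Complex.mul_re, Complex.mul_im]
      linear_combination -s * (T.kind.axis * (chord * (φ / 2))) * hd
    rw [this _ hd, abs_mul, abs_neg, hs, one_mul, abs_of_nonneg (by positivity)]
  rw [apex_eq, wingL_eq, wingR_eq, opp_eq]
  exact ⟨by simpa using key 1 (by simp), by simpa [neg_div] using key (-1) (by simp)⟩

lemma volume_line (d : Circle) (a : ℂ) :
    volume {z : ℂ | ((starRingEnd ℂ d) * (z - a)).im = 0} = 0 := by
  let f : ℂ →ₗ[ℝ] ℝ := Complex.imLm ∘ₗ LinearMap.mulLeft ℝ (starRingEnd ℂ (d : ℂ))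
  have hf : ∀ z, f z = ((starRingEnd ℂ d) * z).im := fun z => rfl
  have : {z : ℂ | ((starRingEnd ℂ d) * (z - a)).im = 0}
      = (fun z => -a + z) ⁻¹' (LinearMap.ker f : Set ℂ) := by
    ext z
    simp only [Set.mem_ofPred_eq, Set.mem_preimage, SetLike.mem_coe, LinearMap.mem_ker, hf,
      neg_add_eq_sub]
  rw [this, measure_preimage_add]
  refine Measure.addHaar_submodule _ _ fun h => ?_
  have h1 : (d : ℂ) * Complex.I ∈ LinearMap.ker f := by rw [h]; trivial
  rw [LinearMap.mem_ker, hf, ← mul_assoc, mul_comm (starRingEnd ℂ _),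
    mul_conj_of_norm (Circle.norm_coe d)] at h1
  simp at h1

lemma Tile.volume_inter_halves (T : Tile) :
    volume (convexHull ℝ {T.apex, T.wingL, T.opp} ∩ convexHull ℝ {T.apex, T.wingR, T.opp}) = 0 := by
  refine measure_mono_null ?_ (volume_line T.dir T.apex)
  let f : ℂ →ₗ[ℝ] ℝ := Complex.imLm ∘ₗ LinearMap.mulLeft ℝ (starRingEnd ℂ (T.dir : ℂ))
  have hf : ∀ z, f z = ((starRingEnd ℂ T.dir) * z).im := fun z => rfl
  have hp : ∀ x y, f (T.point x y - T.apex) = chord * y := by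
    intro x y
    rw [hf, point, add_sub_cancel_left, ← mul_assoc, mul_comm (starRingEnd ℂ _),
      mul_conj_of_norm (Circle.norm_coe _), one_mul, pt]
  have hc := chord_pos
  have hφ := phi_gt
  rintro z ⟨h₁, h₂⟩
  have k₁ : 0 ≤ f (z - T.apex) := by
    have hconv : Convex ℝ {z | f T.apex ≤ f z} := convex_halfSpace_ge f.isLinear _
    have := convexHull_min (s := {T.apex, T.wingL, T.opp}) ?_ hconv h₁
    · rw [map_sub]; exact sub_nonneg.2 this
    · rintro x (rfl | rfl | rfl) <;> rw [Set.mem_ofPred_eq, ← sub_nonneg] <;> rw [← map_sub]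
      · simp
      · rw [wingL_eq, hp]; positivity
      · rw [opp_eq, hp]; simp
  have k₂ : f (z - T.apex) ≤ 0 := by
    have hconv : Convex ℝ {z | f z ≤ f T.apex} := convex_halfSpace_le f.isLinear _
    have := convexHull_min (s := {T.apex, T.wingR, T.opp}) ?_ hconv h₂
    · rw [map_sub]; exact sub_nonpos.2 this
    · rintro x (rfl | rfl | rfl) <;> rw [Set.mem_ofPred_eq, ← sub_nonpos] <;> rw [← map_sub]
      · simp
      · rw [wingR_eq, hp]; nlinarith
      · rw [opp_eq, hp]; simp
  exact le_antisymm k₂ k₁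

lemma Tile.volume_region_eq (T : Tile) : volume T.region
    = ENNReal.ofReal (T.kind.axis * (chord * φ)) * triangleArea := by
  have h := measure_union_add_inter (μ := volume) (convexHull ℝ {T.apex, T.wingL, T.opp})
    T.isClosed_hulls.2.measurableSet
  rw [T.volume_inter_halves, add_zero, T.volume_halves.1, T.volume_halves.2, ← add_mul,
    ← ENNReal.ofReal_add] at h
  · rw [region, h]; congr 2; ring
  all_goals
    have := chord_pos
    have := phi_gt
    have : 0 ≤ T.kind.axis := by cases T.kind <;> simp only [Kind.axis] <;> linarith
    positivity

lemma triangleArea_ne_top : triangleArea ≠ ∞ :=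
  (Set.Finite.isCompact_convexHull (𝕜 := ℝ) (Set.toFinite _)).measure_lt_top.ne

lemma dartArea_eq : dartArea = chord * φ * triangleArea.toReal := by
  have := chord_pos
  have := phi_gt
  rw [dartArea, Tile.volume_region_eq, ENNReal.toReal_mul, ENNReal.toReal_ofReal]
  · simp [Kind.axis]
  · simp only [Kind.axis]; positivity

lemma Tile.volume_region (T : Tile) :
    volume T.region = ENNReal.ofReal (T.kind.axis * dartArea) := by
  have := chord_pos
  have := phi_gt
  have : 0 ≤ T.kind.axis := by cases T.kind <;> simp only [Kind.axis] <;> linarith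
  rw [volume_region_eq, dartArea_eq, ← mul_assoc T.kind.axis (chord * φ),
    ENNReal.ofReal_mul (p := _ * (chord * φ))
    (by positivity), ENNReal.ofReal_toReal triangleArea_ne_top]

lemma dartArea_pos : 0 < dartArea := by
  have h : 0 < volume (Tile.region ⟨.dart, 0, 1⟩) := by
    refine Measure.measure_pos_of_nonempty_interior _ ?_
    exact (Tile.convexHull_interior_nonempty _).1.mono (interior_mono Set.subset_union_left)
  rw [Tile.volume_region, ENNReal.ofReal_pos] at h
  simpa [Kind.axis] using h

lemma Kind.one_le_axis (K : Kind) : 1 ≤ K.axis := by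
  cases K <;> simp only [Kind.axis] <;> linarith [phi_gt]

lemma Tile.volume_interior (T : Tile) : volume (interior T.region) = volume T.region := by
  apply measure_interior_of_null_frontier
  refine measure_mono_null (frontier_union_subset _ _) (measure_union_null ?_ ?_)
  · exact measure_mono_null Set.inter_subset_left ((convex_convexHull ℝ _).addHaar_frontier _)
  · exact measure_mono_null Set.inter_subset_right ((convex_convexHull ℝ _).addHaar_frontier _)

variable {τ : Set Tile}

/-- Packing bound. The length of the axis serves as area in units of a dart. -/
lemma IsPenroseTiling.sum_axis_le (hτ : IsPenroseTiling τ) {F : Finset Tile} (hF : ↑F ⊆ τ)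
    {W : Set ℂ} {a : ℝ} (ha : 0 ≤ a) (hW : volume W ≤ ENNReal.ofReal a)
    (h : ∀ T ∈ F, T.region ⊆ W) : (∑ T ∈ F, T.kind.axis) * dartArea ≤ a := by
  have h₁ : volume (⋃ T ∈ F, interior T.region) = ∑ T ∈ F, volume (interior T.region) :=
    measure_biUnion_finset (hτ.disjoint_interiors.subset hF)
      fun T _ => isOpen_interior.measurableSet
  have h₂ : volume (⋃ T ∈ F, interior T.region) ≤ volume W :=
    measure_mono (Set.iUnion₂_subset fun T hT => interior_subset.trans (h T hT))
  rw [h₁] at h₂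
  simp only [Tile.volume_interior, Tile.volume_region] at h₂
  rw [← ENNReal.ofReal_sum_of_nonneg, ← Finset.sum_mul] at h₂
  · exact (ENNReal.ofReal_le_ofReal_iff ha).1 (h₂.trans hW)
  · intro T _
    exact mul_nonneg (zero_le_one.trans T.kind.one_le_axis) dartArea_pos.le

/-- Covering bound, the counterpart of the packing bound. -/
lemma le_sum_axis {F : Finset Tile} {W : Set ℂ} {a : ℝ}
    (hW : ENNReal.ofReal a ≤ volume W) (h : W ⊆ ⋃ T ∈ F, T.region) :
    a ≤ (∑ T ∈ F, T.kind.axis) * dartArea := by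
  have h₁ := (measure_mono h).trans (measure_biUnion_finset_le (μ := volume) F Tile.region)
  simp only [Tile.volume_region] at h₁
  have h0 : ∀ T ∈ F, 0 ≤ T.kind.axis * dartArea := fun T _ =>
    mul_nonneg (zero_le_one.trans T.kind.one_le_axis) dartArea_pos.le
  rw [← ENNReal.ofReal_sum_of_nonneg h0, ← Finset.sum_mul] at h₁
  exact (ENNReal.ofReal_le_ofReal_iff (by rw [Finset.sum_mul]; exact Finset.sum_nonneg h0)).1
    (hW.trans h₁)

lemma IsPenroseTiling.card_le (hτ : IsPenroseTiling τ) {F : Finset Tile} (hF : ↑F ⊆ τ)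
    {W : Set ℂ} {a : ℝ} (ha : 0 ≤ a) (hW : volume W ≤ ENNReal.ofReal a)
    (h : ∀ T ∈ F, T.region ⊆ W) : F.card * dartArea ≤ a := by
  refine le_trans ?_ (hτ.sum_axis_le hF ha hW h)
  refine mul_le_mul_of_nonneg_right ?_ dartArea_pos.le
  rw [← nsmul_one, ← Finset.sum_const]
  exact Finset.sum_le_sum fun T _ => T.kind.one_le_axis

lemma IsPenroseTiling.finite_of_subset (hτ : IsPenroseTiling τ) {W : Set ℂ}
    (hW : volume W ≠ ∞) : {T ∈ τ | T.region ⊆ W}.Finite := by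
  by_contra hinf
  obtain ⟨n, hn⟩ := exists_nat_gt ((volume W).toReal / dartArea)
  obtain ⟨F, hF, hc⟩ := Set.Infinite.exists_subset_card_eq hinf n
  have := hτ.card_le (fun T hT => (hF hT).1) ENNReal.toReal_nonneg (ENNReal.ofReal_toReal hW).ge
    fun T hT => (hF hT).2
  rw [hc] at this
  rw [div_lt_iff₀ dartArea_pos] at hn
  linarith

lemma IsPenroseTiling.finite_of_bounded (hτ : IsPenroseTiling τ) (c : ℂ) (R : ℝ) :
    {T ∈ τ | dist T.apex c ≤ R}.Finite := by
  refine (hτ.finite_of_subset (W := Metric.closedBall c (R + 2))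
    measure_closedBall_lt_top.ne).subset fun T hT => ⟨hT.1, fun z hz => ?_⟩
  have := Tile.dist_le_two hz T.apex_mem_region
  have := dist_triangle z T.apex c
  have := hT.2
  rw [Metric.mem_closedBall]; linarith

end

section
/-! ### The conjugates of the vertices are bounded -/

/-- The coordinate of a point in the direction `u * zeta ^ n`. -/
def coord (u : ℂ) (n : ZMod 10) (z : ℂ) : ℝ := ((starRingEnd ℂ (u * unit n)) * z).re

/-- The coordinate of the conjugate of a point in the direction `zeta ^ (3 * n)`. -/
def coordConj (S : ℂ →+ ℂ) (n : ZMod 10) (z : ℂ) : ℝ := ((starRingEnd ℂ (unit (3 * n))) * S z).re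

/-- zeta² + zeta⁸ = 2 cos 72° = φ - 1, which is less than 1: the source of the contraction in the
plane. -/
lemma coord_relation (u : ℂ) (n : ZMod 10) (z : ℂ) :
    coord u (n + 2) z + coord u (n + 8) z = (φ - 1) * coord u n z := by
  have h : unit (n + 2) + unit (n + 8) = ((φ - 1 : ℝ) : ℂ) * unit n := by
    rw [unit_add, unit_add, ← mul_add, unit_table 2 _ _ rfl, unit_table 8 _ _ rfl, pt_add,
      ofReal_eq_pt, mul_comm]
    congr 1
    apply pt_congr <;> ring
  rw [coord, coord, ← Complex.add_re, ← add_mul, ← map_add, ← mul_add, h, mul_left_comm, map_mul,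
    Complex.conj_ofReal, mul_assoc, Complex.re_ofReal_mul, coord]

/-- Under zeta ↦ zeta³ the same sum becomes zeta⁶ + zeta⁴ = -φ, of modulus greater than 1: conjugate
coordinates expand where plane coordinates contract. -/
lemma coordConj_relation (S : ℂ →+ ℂ) (n : ZMod 10) (z : ℂ) :
    coordConj S (n + 2) z + coordConj S (n + 8) z = -φ * coordConj S n z := by
  have h : unit (3 * (n + 2)) + unit (3 * (n + 8)) = ((-φ : ℝ) : ℂ) * unit (3 * n) := by
    rw [mul_add, mul_add, show (3 * 2 : ZMod 10) = 6 from rfl, show (3 * 8 : ZMod 10) = 4 from rfl,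
      unit_add, unit_add, ← mul_add, unit_table 6 _ _ rfl, unit_table 4 _ _ rfl, pt_add,
      ofReal_eq_pt, mul_comm]
    congr 1
    apply pt_congr <;> ring
  rw [coordConj, coordConj, ← Complex.add_re, ← add_mul, ← map_add, h, map_mul,
    Complex.conj_ofReal, mul_assoc, Complex.re_ofReal_mul, coordConj]

lemma coord_add (u : ℂ) (n : ZMod 10) (z w : ℂ) :
    coord u n (z + w) = coord u n z + coord u n w := by
  rw [coord, mul_add, Complex.add_re]; rfl

lemma abs_coord_sub_le {u : ℂ} (hu : ‖u‖ = 1) (n : ZMod 10) (z w : ℂ) :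
    |coord u n z - coord u n w| ≤ dist z w := by
  rw [coord, coord, ← Complex.sub_re, ← mul_sub]
  refine (Complex.abs_re_le_norm _).trans ?_
  rw [norm_mul, RCLike.norm_conj, norm_mul, norm_unit, hu, dist_eq_norm, one_mul, one_mul]

lemma abs_coordConj_sub_le (S : ℂ →+ ℂ) (n : ZMod 10) (z w : ℂ) :
    |coordConj S n z - coordConj S n w| ≤ ‖S z - S w‖ := by
  rw [coordConj, coordConj, ← Complex.sub_re, ← mul_sub]
  refine (Complex.abs_re_le_norm _).trans ?_
  rw [norm_mul, RCLike.norm_conj, norm_unit, one_mul]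

instance : Finite Kind :=
  Finite.of_surjective (fun b : Bool => if b then Kind.kite else Kind.dart) fun K => by
    cases K
    · exact ⟨true, rfl⟩
    · exact ⟨false, rfl⟩

variable {τ : Set Tile} {S : ℂ →+ ℂ} {u : ℂ}

lemma IsConj.map_point_sub (hS : IsConj S) {T : Tile} {j : ZMod 10} (hj : (T.dir : ℂ) = u * unit j)
    (x y : ℝ) : S (T.point x y) - S T.apex = unit (3 * j) * S (u * pt x y) := by
  rw [Tile.point, map_add, add_sub_cancel_left, hj, mul_comm u, mul_assoc, hS.map_unit_mul]

/-- Up to rotation, the conjugates of these points relative to the apex depend only on the kind of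
the tile and an index, so there are finitely many. -/
lemma IsConj.exists_bound (hS : IsConj S) (hu : ∀ T ∈ τ, ∃ j, (T.dir : ℂ) = u * unit j) :
    ∃ B, ∀ T ∈ τ, (∀ n, ‖S (T.exit n) - S T.apex‖ ≤ B) ∧
      ∀ k, ‖S (T.head k) - S T.apex‖ ≤ B ∧ ‖S (T.tail k) - S T.apex‖ ≤ B := by
  obtain ⟨B₁, h₁⟩ := (Set.finite_range fun p : Kind × ZMod 10 =>
    ‖S (u * pt (exitCoord p.1 p.2).1 (exitCoord p.1 p.2).2)‖).bddAbove
  obtain ⟨B₂, h₂⟩ := (Set.finite_range fun p : Kind × Edge =>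
    ‖S (u * pt (headCoord p.1 p.2).1 (headCoord p.1 p.2).2)‖).bddAbove
  obtain ⟨B₃, h₃⟩ := (Set.finite_range fun p : Kind × Edge =>
    ‖S (u * pt (tailCoord p.1 p.2).1 (tailCoord p.1 p.2).2)‖).bddAbove
  refine ⟨max B₁ (max B₂ B₃), fun T hT => ?_⟩
  obtain ⟨j, hj⟩ := hu T hT
  refine ⟨fun n => ?_, fun k => ⟨?_, ?_⟩⟩
  · rw [Tile.exit_eq, hS.map_point_sub hj, norm_mul, norm_unit, one_mul]
    exact (h₁ ⟨(T.kind, n), rfl⟩).trans (by simp)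
  · rw [Tile.head, hS.map_point_sub hj, norm_mul, norm_unit, one_mul]
    exact (h₂ ⟨(T.kind, k), rfl⟩).trans (by simp)
  · rw [Tile.tail, hS.map_point_sub hj, norm_mul, norm_unit, one_mul]
    exact (h₃ ⟨(T.kind, k), rfl⟩).trans (by simp)

lemma Tile.exists_barVec {T : Tile} {j : ZMod 10} (hj : (T.dir : ℂ) = u * unit j) (n : ZMod 10) :
    T.barVec (n - j) = pt 0 1 * (u * unit n) := by
  rw [barVec, hj, mul_assoc u, ← unit_add, add_sub_cancel]

lemma conj_mul_self_of_norm {w : ℂ} (hw : ‖w‖ = 1) (z : ℂ) : starRingEnd ℂ w * (z * w) = z := by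
  rw [mul_comm, mul_assoc, mul_conj_of_norm hw, mul_one]

lemma coord_bar (hu : ‖u‖ = 1) (n : ZMod 10) (x : ℝ) :
    coord u n (pt 0 1 * (u * unit n) * (x : ℂ)) = 0 := by
  have : ‖u * unit n‖ = 1 := by rw [norm_mul, hu, norm_unit, one_mul]
  rw [coord, ← mul_assoc, conj_mul_self_of_norm this, Complex.re_mul_ofReal, pt, zero_mul]

lemma IsConj.coordConj_bar (hS : IsConj S) (hSu : S u = 1) (n : ZMod 10) (r : ℝ) :
    ((starRingEnd ℂ (unit (3 * n))) * ((r : ℂ) * S (pt 0 1 * (u * unit n)))).re = 0 := by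
  rw [hS.map_pt_mul, mul_comm u, hS.map_unit_mul, hSu, mul_one, mul_left_comm,
    conj_mul_self_of_norm (norm_unit _), Complex.re_ofReal_mul, pt, mul_zero]

/-- There is a tile near the intersection of an Ammann bar near one tile and an Ammann bar near
another tile, with the corresponding coordinates of its conjugate. -/
lemma IsPenroseTiling.exists_mix (hτ : IsPenroseTiling τ) (hS : IsConj S) (hu : ‖u‖ = 1)
    (hSu : S u = 1) (hdir : ∀ T ∈ τ, ∃ j, (T.dir : ℂ) = u * unit j) :
    ∃ C, ∀ T ∈ τ, ∀ T' ∈ τ, ∀ n, ∃ V ∈ τ,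
      |coord u n V.apex - coord u n T.apex| ≤ C ∧
      |coordConj S n V.apex - coordConj S n T.apex| ≤ C ∧
      |coord u (n + 8) V.apex - coord u (n + 8) T'.apex| ≤ C ∧
      |coordConj S (n + 8) V.apex - coordConj S (n + 8) T'.apex| ≤ C := by
  obtain ⟨B, hB⟩ := hS.exists_bound hdir
  -- Two tile diameters make 4. Under `S` the two ends of bars cost `2 * B`, and another `2 * B` is
  -- spent when the second line runs through the neighbour `V'` instead of `V`.
  refine ⟨max 4 (4 * B), fun T hT T' hT' n => ?_⟩
  obtain ⟨j, hj⟩ := hdir T hT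
  obtain ⟨j', hj'⟩ := hdir T' hT'
  have hb := Tile.exists_barVec hj n
  have hb' := Tile.exists_barVec hj' (n + 8)
  have him : ((starRingEnd ℂ (T.barVec (n - j))) * T'.barVec (n + 8 - j')).im ≠ 0 := by
    have h1 : ‖u * unit n‖ = 1 := by rw [norm_mul, hu, norm_unit, one_mul]
    have : (starRingEnd ℂ (T.barVec (n - j))) * T'.barVec (n + 8 - j')
        = (starRingEnd ℂ (u * unit n) * (unit 8 * (u * unit n)))
          * ((starRingEnd ℂ (pt 0 1)) * pt 0 1) := by
      rw [hb, hb', unit_add, map_mul]; ring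
    rw [this, conj_mul_self_of_norm h1, mul_comm (starRingEnd ℂ _), Complex.mul_conj,
      Complex.im_mul_ofReal, unit_table 8 _ _ rfl]
    have hc := chord_pos
    have hφ := phi_gt
    simp only [pt, Complex.normSq_apply]
    have : 0 < chord * chord := by positivity
    have : 0 < chord * φ := by positivity
    apply ne_of_lt
    nlinarith
  obtain ⟨V, hV, V', hV', z, x, x', r, r', m, m', hzV, hzV', hadj, -, -, hz, hz', hr, hr'⟩ :=
    hτ.cross hS hT hT' him
  rw [hb] at hz hr
  rw [hb'] at hz' hr'
  have hX : ∀ (A D : Tile) (i i' : ZMod 10) (t : ℝ), z ∈ A.region →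
      z = D.exit i + pt 0 1 * (u * unit i') * (t : ℂ) →
      |coord u i' A.apex - coord u i' D.apex| ≤ 4 := by
    intro A D i i' t hzA hzD
    have h₁ := (abs_coord_sub_le hu i' A.apex z).trans (Tile.dist_le_two A.apex_mem_region hzA)
    have h₂ := (abs_coord_sub_le hu i' (D.exit i) D.apex).trans
      (Tile.dist_le_two (D.exit_mem_region i) D.apex_mem_region)
    rw [hzD, coord_add, coord_bar hu, add_zero] at h₁
    rw [abs_le] at h₁ h₂ ⊢
    constructor <;> linarith
  have hXS : ∀ A ∈ τ, ∀ D ∈ τ, ∀ (l i i' : ZMod 10) (t : ℝ),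
      S (A.exit l) = S (D.exit i) + (t : ℂ) * S (pt 0 1 * (u * unit i')) →
      |coordConj S i' A.apex - coordConj S i' D.apex| ≤ 2 * B := by
    intro A hA D hD l i i' t h
    have h₁ := (abs_coordConj_sub_le S i' (A.exit l) A.apex).trans ((hB A hA).1 l)
    have h₂ := (abs_coordConj_sub_le S i' (D.exit i) D.apex).trans ((hB D hD).1 i)
    have h₃ : coordConj S i' (A.exit l) = coordConj S i' (D.exit i) := by
      rw [coordConj, h, mul_add, Complex.add_re, hS.coordConj_bar hSu, add_zero, coordConj]
    rw [h₃] at h₁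
    rw [abs_le] at h₁ h₂ ⊢
    constructor <;> linarith
  have hB0 : 0 ≤ B := (norm_nonneg _).trans ((hB T hT).1 0)
  have hVV' : |coordConj S (n + 8) V.apex - coordConj S (n + 8) V'.apex| ≤ 2 * B := by
    rcases hadj with rfl | ⟨k, k', ha⟩
    · rw [sub_self, abs_zero]; linarith
    · have h₁ := (abs_coordConj_sub_le S (n + 8) (V.head k) V.apex).trans ((hB V hV).2 k).1
      have h₂ := (abs_coordConj_sub_le S (n + 8) (V'.head k') V'.apex).trans ((hB V' hV').2 k').1
      rw [ha.head] at h₂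
      rw [abs_le] at h₁ h₂ ⊢
      constructor <;> linarith
  refine ⟨V, hV, (hX V T _ n x hzV hz).trans (le_max_left _ _),
    ((hXS V hV T hT _ _ n r hr).trans (by linarith)).trans (le_max_right _ _),
    (hX V T' _ (n + 8) x' hzV hz').trans (le_max_left _ _), le_trans ?_ (le_max_right _ _)⟩
  have := hXS V' hV' T' hT' _ _ (n + 8) r' hr'
  rw [abs_le] at this hVV' ⊢
  constructor <;> linarith

lemma unit_conj_bound {z : ℂ} {n : ZMod 10} {R : ℝ} (h₁ : |((starRingEnd ℂ (unit n)) * z).re| ≤ R)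
    (h₂ : |((starRingEnd ℂ (unit (n + 8))) * z).re| ≤ R) : ‖z‖ ≤ 10 * R := by
  have hw : z = unit n * ((starRingEnd ℂ (unit n)) * z) := by
    rw [← mul_assoc, mul_conj_of_norm (norm_unit n), one_mul]
  set w := (starRingEnd ℂ (unit n)) * z with hwdef
  have hn : ‖z‖ = ‖w‖ := by rw [hw, norm_mul, norm_unit, one_mul]
  rw [unit_add, map_mul, mul_comm (starRingEnd ℂ (unit n)), mul_assoc, ← hwdef,
    unit_table 8 _ _ rfl] at h₂
  have g := phi_gt
  have g' := phi_lt
  have hc : (1 : ℝ) ≤ chord := by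
    have := chord_pos; have := chord_sq; nlinarith
  simp only [pt, Complex.mul_re, Complex.conj_re, Complex.conj_im] at h₂
  have hR : 0 ≤ R := (abs_nonneg _).trans h₁
  have him : |w.im| ≤ 4 * R := by
    have hcφ : (1 / 2 : ℝ) ≤ chord * (φ / 2) := by nlinarith
    rw [abs_le] at h₁ h₂
    have h3 : |chord * (φ / 2) * w.im| ≤ 2 * R := by
      rw [abs_le]; constructor <;> nlinarith
    rw [abs_mul, abs_of_nonneg (by linarith : 0 ≤ chord * (φ / 2))] at h3
    nlinarith [abs_nonneg w.im]
  rw [hn]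
  refine (Complex.norm_le_abs_re_add_abs_im w).trans ?_
  linarith

/-- The conjugates of the vertices of a Penrose tiling are bounded. -/
theorem IsPenroseTiling.exists_conj_bound (hτ : IsPenroseTiling τ) {T₀ : Tile} (hT₀ : T₀ ∈ τ) :
    ∃ S : ℂ →+ ℂ, IsConj S ∧ S T₀.dir = 1 ∧ ∃ B, ∀ T ∈ τ, ‖S T.apex‖ ≤ B := by
  obtain ⟨S, hS, hSu⟩ := exists_isConj (Circle.coe_ne_zero T₀.dir)
  refine ⟨S, hS, hSu, ?_⟩
  have hu : ‖(T₀.dir : ℂ)‖ = 1 := Circle.norm_coe _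
  obtain ⟨u, hudef⟩ : ∃ u : ℂ, u = T₀.dir := ⟨_, rfl⟩
  rw [← hudef] at hSu hu
  obtain ⟨C, hC⟩ := hτ.exists_mix hS hu hSu fun T hT => by
    rw [hudef]; exact hτ.exists_dir hT₀ hT
  have hC0 : 0 ≤ C := by
    obtain ⟨V, -, h, -⟩ := hC T₀ hT₀ T₀ hT₀ 0
    exact (abs_nonneg _).trans h
  let X : ZMod 10 → Tile → ℝ := fun n T => coord u n T.apex - coord u n T₀.apex
  let X' : ZMod 10 → Tile → ℝ := fun n T => coordConj S n T.apex - coordConj S n T₀.apex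
  have hX : ∀ n T, X (n + 2) T + X (n + 8) T = (φ - 1) * X n T := by
    intro n T
    have h₁ := coord_relation u n T.apex
    have h₂ := coord_relation u n T₀.apex
    simp only [X]; linarith
  have hX' : ∀ n T, X' (n + 2) T + X' (n + 8) T = -φ * X' n T := by
    intro n T
    have h₁ := coordConj_relation S n T.apex
    have h₂ := coordConj_relation S n T₀.apex
    simp only [X']; linarith
  have mix : ∀ T ∈ τ, ∀ n, ∃ V ∈ τ, |X n V - X n T| ≤ C ∧ |X' n V - X' n T| ≤ C ∧
      |X (n + 8) V| ≤ C ∧ |X' (n + 8) V| ≤ C := by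
    intro T hT n
    obtain ⟨V, hV, h₁, h₂, h₃, h₄⟩ := hC T hT T₀ hT₀ n
    exact ⟨V, hV, by simpa [X] using h₁, by simpa [X'] using h₂, h₃, h₄⟩
  have g := phi_gt
  have g' := phi_lt
  have p := phi_sq
  -- Bounding one coordinate of `T` leaves infinitely many tiles. But the tile where its bar crosses
  -- one of `T₀` lies in a bounded region, hence is one of finitely many, and its conjugate
  -- coordinate differs by at most `C`.
  have local_bound : ∀ R, ∃ M, ∀ T ∈ τ, ∀ n, |X n T| ≤ R → |X' n T| ≤ M := by
    intro R
    have hfin := hτ.finite_of_bounded T₀.apex (10 * (R + C))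
    obtain ⟨M, hM⟩ := (hfin.image fun T => ‖S T.apex - S T₀.apex‖).bddAbove
    refine ⟨M + C, fun T hT n h => ?_⟩
    obtain ⟨V, hV, h₁, h₂, h₃, -⟩ := mix T hT n
    have hVn : ‖V.apex - T₀.apex‖ ≤ 10 * (R + C) := by
      have e : ∀ i, X i V
          = ((starRingEnd ℂ (unit i)) * ((starRingEnd ℂ u) * (V.apex - T₀.apex))).re := by
        intro i
        simp only [X, coord]
        rw [← Complex.sub_re, ← mul_sub, map_mul]
        congr 1; ring
      have := unit_conj_bound (z := (starRingEnd ℂ u) * (V.apex - T₀.apex)) (n := n) (R := R + C)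
        ?_ ?_
      · rwa [norm_mul, RCLike.norm_conj, hu, one_mul] at this
      · rw [← e]; rw [abs_le] at h₁ h ⊢; constructor <;> linarith
      · rw [← e]; refine h₃.trans ?_; linarith [(abs_nonneg _).trans h]
    have h₄ : ‖S V.apex - S T₀.apex‖ ≤ M := hM ⟨V, ⟨hV, by rwa [dist_eq_norm]⟩, rfl⟩
    have h₅ := (abs_coordConj_sub_le S n V.apex T₀.apex).trans h₄
    change |X' n V| ≤ M at h₅
    rw [abs_le] at h₂ h₅ ⊢
    constructor <;> linarith
  -- Coordinate `n + 8` of the crossing tile is nearly 0, so the three-term relations reduce to X (n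
  -- + 2) V ≈ (φ - 1) X n T and, as 1/φ = φ - 1, to X' n T ≈ -(φ - 1) X' (n + 2) V.
  have step : ∀ T ∈ τ, ∀ n, ∃ V ∈ τ, |X (n + 2) V| ≤ (φ - 1) * |X n T| + 2 * C ∧
      |X' n T| ≤ (φ - 1) * |X' (n + 2) V| + 2 * C := by
    intro T hT n
    obtain ⟨V, hV, h₁, h₂, h₃, h₄⟩ := mix T hT n
    refine ⟨V, hV, ?_, ?_⟩
    · have e : X (n + 2) V = (φ - 1) * (X n V - X n T) + (φ - 1) * X n T - X (n + 8) V := by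
        rw [← add_sub_cancel_right (X (n + 2) V) (X (n + 8) V), hX]; ring
      rw [e]
      have a₁ := abs_sub ((φ - 1) * (X n V - X n T) + (φ - 1) * X n T) (X (n + 8) V)
      have a₂ := abs_add_le ((φ - 1) * (X n V - X n T)) ((φ - 1) * X n T)
      rw [abs_mul, abs_mul, abs_of_pos (by linarith : 0 < φ - 1)] at a₂
      nlinarith
    · have e : X' n T = -(φ - 1) * X' (n + 2) V - (φ - 1) * X' (n + 8) V
          - (X' n V - X' n T) := by
        have := hX' n V
        have h' : (φ - 1) * (X' (n + 2) V + X' (n + 8) V) = -X' n V := by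
          rw [this]; linear_combination (-X' n V) * p
        linear_combination h'
      have a₁ := abs_sub (-(φ - 1) * X' (n + 2) V - (φ - 1) * X' (n + 8) V) (X' n V - X' n T)
      have a₂ := abs_sub (-(φ - 1) * X' (n + 2) V) ((φ - 1) * X' (n + 8) V)
      rw [abs_mul, abs_mul, abs_neg, abs_of_pos (by linarith : 0 < φ - 1)] at a₂
      rw [← e] at a₁
      nlinarith
  have bound : ∀ T ∈ τ, ∀ n, |X' n T| ≤ 10 * C := by
    intro T hT n
    -- The summand `10 * C` ensures (φ - 1)R + 2C ≤ R, so the range of the plane coordinates is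
    -- preserved. Likewise `6 * C` below exceeds the fixed point 2C/(2 - φ) of the recursion for the
    -- conjugates.
    obtain ⟨M, hM⟩ := local_bound (|X n T| + 10 * C)
    set R := |X n T| + 10 * C with hR
    have iter : ∀ i : ℕ, ∀ V ∈ τ, ∀ m, |X m V| ≤ R →
        |X' m V| ≤ (φ - 1) ^ i * M + 6 * C := by
      intro i
      induction i with
      | zero =>
        intro V hV m h
        have := hM V hV m h
        rw [pow_zero, one_mul]; linarith
      | succ i ih =>
        intro V hV m h
        obtain ⟨W, hW, h₁, h₂⟩ := step V hV m
        have h₃ : |X (m + 2) W| ≤ R := by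
          have : 0 ≤ |X n T| := abs_nonneg _
          nlinarith [mul_le_mul_of_nonneg_left h (by linarith : 0 ≤ φ - 1)]
        have h₄ := mul_le_mul_of_nonneg_left (ih W hW _ h₃) (by linarith : 0 ≤ φ - 1)
        rw [pow_succ]
        nlinarith
    have hlim : Filter.Tendsto (fun i : ℕ => (φ - 1) ^ i * M + 6 * C) Filter.atTop
        (nhds (0 * M + 6 * C)) :=
      ((tendsto_pow_atTop_nhds_zero_of_lt_one (by linarith) (by linarith)).mul_const M).add_const _
    have := ge_of_tendsto' hlim fun i => iter i T hT n (by rw [hR]; linarith)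
    linarith
  refine ⟨10 * (10 * C) + ‖S T₀.apex‖, fun T hT => ?_⟩
  have h := unit_conj_bound (z := S T.apex - S T₀.apex) (n := 3 * 0) (R := 10 * C) ?_ ?_
  · have := norm_sub_norm_le (S T.apex) (S T₀.apex)
    linarith
  · have := bound T hT 0
    simp only [X', coordConj] at this
    rwa [← Complex.sub_re, ← mul_sub] at this
  -- 3 · 6 = 8 modulo 10, the second direction required by `unit_conj_bound`.
  · have := bound T hT 6
    simp only [X', coordConj] at this
    rw [← Complex.sub_re, ← mul_sub] at this
    exact this

end

section
/-! ### The frequencies of the two kinds of tiles -/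

/-- The conjugate of the signed area spanned by the origin and a directed edge. -/
def conjArea (S : ℂ →+ ℂ) (T : Tile) (k : Edge) : ℝ :=
  (if edgeLeft T.kind k then 1 else -1) * ((starRingEnd ℂ (S (T.head k))) * S (T.tail k)).im

/-- The conjugate of the area of a tile, up to normalization. -/
def Kind.conjWeight : Kind → ℝ
  | .kite => φ - 1
  | .dart => -1

variable {τ : Set Tile} {S : ℂ →+ ℂ} {u : ℂ}

/-- In the frame of the tile a wing is φ·zeta^{±1}, with conjugate (1 - φ)·zeta^{±3}. This lies on
the other side of the axis, so the orientation is reversed. -/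
lemma IsConj.map_wing (hS : IsConj S) (hSu : S u = 1) {T : Tile} {j : ZMod 10}
    (hj : (T.dir : ℂ) = u * unit j) (s : ℝ) (hs : s = 1 ∨ s = -1) :
    S (T.point ((φ + 1) / 2) (s * (φ / 2)))
      = S T.apex + unit (3 * j) * pt (1 / 2 * (1 - φ) ^ 2) (s * (-1 / 2)) := by
  have p := phi_sq
  rw [← sub_eq_iff_eq_add', hS.map_point_sub hj]
  congr 1
  have e : ∀ n : ZMod 10, pt ((φ + 1) / 2) (s * (φ / 2)) = (φ : ℂ) * unit n →
      S (u * pt ((φ + 1) / 2) (s * (φ / 2))) = ((1 - φ : ℝ) : ℂ) * unit (3 * n) := by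
    intro n hn
    rw [hn, mul_left_comm, mul_comm u, hS.map_phi_mul, hS.map_unit_mul, hSu, mul_one]
  rcases hs with rfl | rfl
  · rw [e 1, show (3 * 1 : ZMod 10) = 3 from rfl, unit_table 3 _ _ rfl, ofReal_eq_pt, pt_mul]
    · apply pt_congr <;> linarith
    · rw [unit_table 1 _ _ rfl, ofReal_eq_pt, pt_mul]
      apply pt_congr <;> linarith
  · rw [e 9, show (3 * 9 : ZMod 10) = 7 from rfl, unit_table 7 _ _ rfl, ofReal_eq_pt, pt_mul]
    · apply pt_congr <;> linarith
    · rw [unit_table 9 _ _ rfl, ofReal_eq_pt, pt_mul]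
      apply pt_congr <;> linarith

lemma IsConj.map_axis (hS : IsConj S) (hSu : S u = 1) {T : Tile} {j : ZMod 10}
    (hj : (T.dir : ℂ) = u * unit j) :
    S (T.point φ 0) = S T.apex + unit (3 * j) * pt (1 - φ) 0 ∧
      S (T.point 1 0) = S T.apex + unit (3 * j) * pt 1 0 := by
  constructor <;> rw [← sub_eq_iff_eq_add', hS.map_point_sub hj]
  · rw [← ofReal_eq_pt, mul_comm u, hS.map_phi_mul, hSu, mul_one, ofReal_eq_pt]
  · rw [← one_eq_pt, mul_one, hSu]

/-- The shoelace formula for twice the signed area; the position `a` and the rotation `d` drop out.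
-/
lemma quadrilateral_area {d : ℂ} (hd : ‖d‖ = 1) (a : ℂ) (x y m : ℝ) :
    ((starRingEnd ℂ a) * (a + d * pt x (-y))).im
      + ((starRingEnd ℂ (a + d * pt x (-y))) * (a + d * pt m 0)).im
      + ((starRingEnd ℂ (a + d * pt m 0)) * (a + d * pt x y)).im
      + ((starRingEnd ℂ (a + d * pt x y)) * a).im = 2 * m * y * chord := by
  have hd' : d.re * d.re + d.im * d.im = 1 := by
    rw [← Complex.normSq_apply, Complex.normSq_eq_norm_sq, hd]; norm_num
  simp only [pt, Complex.mul_im, Complex.add_im, Complex.add_re, Complex.mul_re, Complex.conj_re,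
    Complex.conj_im]
  linear_combination 2 * m * y * chord * hd'

/-- The four terms add up to the shoelace sum of the conjugated tile, with half-width -1/2 and axis
1 - φ for the kite, 1 for the dart. -/
lemma IsConj.sum_conjArea (hS : IsConj S) (hSu : S u = 1) {T : Tile} {j : ZMod 10}
    (hj : (T.dir : ℂ) = u * unit j) :
    ∑ k, conjArea S T k = chord * T.kind.conjWeight := by
  have hL := hS.map_wing hSu hj 1 (Or.inl rfl)
  have hR := hS.map_wing hSu hj (-1) (Or.inr rfl)
  obtain ⟨hk, hd⟩ := hS.map_axis hSu hj
  have h0 : S (T.point 0 0) = S T.apex := by rw [← T.apex_eq]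
  rw [one_mul, one_mul] at hL
  rw [neg_one_mul, neg_one_mul, ← neg_div] at hR
  have hq := quadrilateral_area (norm_unit (3 * j)) (S T.apex) (1 / 2 * (1 - φ) ^ 2) (-1 / 2)
  have anti : ∀ v w : ℂ, -((starRingEnd ℂ v) * w).im = ((starRingEnd ℂ w) * v).im := by
    intro v w; simp only [Complex.mul_im, Complex.conj_re, Complex.conj_im]; ring
  rw [Fintype.sum_prod_type, Fintype.sum_bool, Fintype.sum_bool, Fintype.sum_bool]
  rcases hT : T.kind with _ | _ <;>
    simp only [conjArea, Tile.head, Tile.tail, hT, headCoord, tailCoord, wingCoord, edgeLeft,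
      if_true, Bool.false_eq_true, if_false, Kind.conjWeight, beq_self_eq_true, bne_self_eq_false,
      Bool.true_beq, Bool.false_beq, Bool.true_bne, Bool.false_bne, Bool.not_true, Bool.not_false,
      hL, hR, hk, hd, h0, one_mul, neg_one_mul, anti]
  · have := hq (1 - φ)
    linarith
  · have := hq 1
    linarith

lemma unit_injective : Function.Injective unit := by
  intro m n h
  exact ZMod.val_injective 10 (isPrimitiveRoot_zeta.pow_inj (ZMod.val_lt m) (ZMod.val_lt n) h)

lemma edgeDir_injective (K : Kind) : Function.Injective (edgeDir K) := by
  unfold Function.Injective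
  cases K <;> decide

lemma Tile.edgeVec_injective (T : Tile) : Function.Injective T.edgeVec := by
  intro k k' h
  exact edgeDir_injective _ (unit_injective (mul_left_cancel₀ (Circle.coe_ne_zero _) h))

lemma Adj.tail {T T' : Tile} {k k' : Edge} (h : Adj T k T' k') : T'.tail k' = T.tail k := by
  rw [Tile.tail_eq, Tile.tail_eq, h.head, h.vec, edgeLen_congr h.long]

lemma Adj.conjArea_add {T T' : Tile} {k k' : Edge} (h : Adj T k T' k') :
    conjArea S T k + conjArea S T' k' = 0 := by
  rw [conjArea, conjArea, h.head, h.tail]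
  have := h.left
  cases h₁ : edgeLeft T.kind k <;> cases h₂ : edgeLeft T'.kind k' <;> simp_all

lemma Tile.head_mem_region (T : Tile) (k : Edge) : T.head k ∈ T.region := by
  have := T.edge_strip k (t := 0) (y := 0) le_rfl (by norm_num) (by linarith [edgeLen_pos k])
  simpa [pt_zero] using this

/-- In a finite set of tiles, the numbers of kites and darts have the proportion `φ`, up to an
error of the size of the boundary. -/
theorem IsPenroseTiling.exists_conjWeight_bound (hτ : IsPenroseTiling τ) :
    ∃ C, 0 ≤ C ∧ ∀ F G : Finset Tile, ↑F ⊆ τ →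
      (∀ T ∈ F, ∀ T' ∈ τ, T' ∉ F → (T.region ∩ T'.region).Nonempty → T ∈ G) →
      |∑ T ∈ F, T.kind.conjWeight| ≤ C * G.card := by
  classical
  rcases τ.eq_empty_or_nonempty with h | ⟨T₀, hT₀⟩
  · refine ⟨0, le_rfl, fun F G hF _ => ?_⟩
    rw [h, Set.subset_empty_iff, Finset.coe_eq_empty] at hF
    simp [hF]
  obtain ⟨S, hS, hSu, B, hB⟩ := hτ.exists_conj_bound hT₀
  obtain ⟨D, hD⟩ := hS.exists_bound fun T hT => hτ.exists_dir hT₀ hT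
  have hnb : ∀ p : Tile × Edge, ∃ q : Tile × Edge, p.1 ∈ τ → q.1 ∈ τ ∧ Adj p.1 p.2 q.1 q.2 := by
    intro p
    by_cases hp : p.1 ∈ τ
    · obtain ⟨T', hT', k', h⟩ := hτ.exists_adj hp p.2
      exact ⟨(T', k'), fun _ => ⟨hT', h⟩⟩
    · exact ⟨p, fun h => absurd h hp⟩
  choose nb hnb using hnb
  have hc := chord_pos
  have harea : ∀ T ∈ τ, ∀ k, |conjArea S T k| ≤ (B + D) ^ 2 := by
    intro T hT k
    have h₁ : ‖S (T.head k)‖ ≤ B + D := by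
      have := norm_sub_norm_le (S (T.head k)) (S T.apex)
      linarith [hB T hT, ((hD T hT).2 k).1]
    have h₂ : ‖S (T.tail k)‖ ≤ B + D := by
      have := norm_sub_norm_le (S (T.tail k)) (S T.apex)
      linarith [hB T hT, ((hD T hT).2 k).2]
    have hs : |(if edgeLeft T.kind k then 1 else -1 : ℝ)| = 1 := by split_ifs <;> simp
    rw [conjArea, abs_mul, hs, one_mul]
    refine (Complex.abs_im_le_norm _).trans ?_
    rw [norm_mul, RCLike.norm_conj, pow_two]
    exact mul_le_mul h₁ h₂ (norm_nonneg _) ((norm_nonneg _).trans h₁)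
  refine ⟨4 * (B + D) ^ 2 / chord, by positivity, fun F G hF hG => ?_⟩
  let P : Finset (Tile × Edge) := F ×ˢ Finset.univ
  have hP : ∀ p ∈ P, p.1 ∈ τ := fun p hp => hF (Finset.mem_product.1 hp).1
  have htotal : chord * ∑ T ∈ F, T.kind.conjWeight = ∑ p ∈ P, conjArea S p.1 p.2 := by
    rw [Finset.sum_product, Finset.mul_sum]
    refine Finset.sum_congr rfl fun T hT => ?_
    obtain ⟨j, hj⟩ := hτ.exists_dir hT₀ (hF hT)
    exact (hS.sum_conjArea hSu hj).symm
  -- An edge between two tiles of `F` occurs twice, with opposite signs. The map `nb` is an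
  -- involution there because an edge and a side determine the tile.
  have hinner : ∑ p ∈ P with (nb p).1 ∈ F, conjArea S p.1 p.2 = 0 := by
    refine Finset.sum_involution (fun p _ => nb p) ?_ ?_ ?_ ?_
    · intro p hp
      exact (hnb p (hP p (Finset.mem_filter.1 hp).1)).2.conjArea_add
    · intro p hp _ h
      have := (hnb p (hP p (Finset.mem_filter.1 hp).1)).2.left
      rw [h] at this
      exact this rfl
    · intro p hp
      obtain ⟨hp₁, hp₂⟩ := Finset.mem_filter.1 hp
      obtain ⟨h₁, h₂⟩ := hnb p (hP p hp₁)
      obtain ⟨h₃, h₄⟩ := hnb _ h₁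
      have hl : edgeLeft (nb (nb p)).1.kind (nb (nb p)).2 = edgeLeft p.1.kind p.2 := by
        have a := h₂.left
        have b := h₄.left
        revert a b
        cases edgeLeft (nb (nb p)).1.kind (nb (nb p)).2 <;>
          cases edgeLeft (nb p).1.kind (nb p).2 <;> cases edgeLeft p.1.kind p.2 <;> simp
      have e := hτ.eq_of_edge (hP p hp₁) h₃ hl (h₄.head.trans h₂.head) (h₄.vec.trans h₂.vec)
      refine Finset.mem_filter.2 ⟨Finset.mem_product.2 ⟨hp₂, Finset.mem_univ _⟩, ?_⟩
      rw [e]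
      exact (Finset.mem_product.1 hp₁).1
    · intro p hp
      obtain ⟨hp₁, hp₂⟩ := Finset.mem_filter.1 hp
      obtain ⟨h₁, h₂⟩ := hnb p (hP p hp₁)
      obtain ⟨h₃, h₄⟩ := hnb _ h₁
      have hl : edgeLeft (nb (nb p)).1.kind (nb (nb p)).2 = edgeLeft p.1.kind p.2 := by
        have a := h₂.left
        have b := h₄.left
        revert a b
        cases edgeLeft (nb (nb p)).1.kind (nb (nb p)).2 <;>
          cases edgeLeft (nb p).1.kind (nb p).2 <;> cases edgeLeft p.1.kind p.2 <;> simp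
      have e := hτ.eq_of_edge (hP p hp₁) h₃ hl (h₄.head.trans h₂.head) (h₄.vec.trans h₂.vec)
      refine Prod.ext e (p.1.edgeVec_injective ?_)
      have := h₄.vec.trans h₂.vec
      rwa [e] at this
  -- A tile with a neighbour outside `F` shares a vertex with it, hence belongs to `G`; it has four
  -- edges.
  have houter : |∑ p ∈ P with ¬(nb p).1 ∈ F, conjArea S p.1 p.2| ≤ 4 * (B + D) ^ 2 * G.card := by
    refine (Finset.abs_sum_le_sum_abs _ _).trans ?_
    have h₁ : ∑ p ∈ P with ¬(nb p).1 ∈ F, |conjArea S p.1 p.2|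
        ≤ (P.filter fun p => ¬(nb p).1 ∈ F).card • (B + D) ^ 2 :=
      Finset.sum_le_card_nsmul _ _ _ fun p hp =>
        harea _ (hP p (Finset.mem_filter.1 hp).1) _
    have h₂ : (P.filter fun p => ¬(nb p).1 ∈ F).card ≤ G.card * 4 := by
      have hsub : (P.filter fun p => ¬(nb p).1 ∈ F) ⊆ G ×ˢ Finset.univ := by
        intro p hp
        obtain ⟨hp₁, hp₂⟩ := Finset.mem_filter.1 hp
        obtain ⟨h₁, h₂⟩ := hnb p (hP p hp₁)
        refine Finset.mem_product.2 ⟨hG _ (Finset.mem_product.1 hp₁).1 _ h₁ hp₂ ?_,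
          Finset.mem_univ _⟩
        refine ⟨p.1.head p.2, p.1.head_mem_region _, ?_⟩
        rw [← h₂.head]
        exact Tile.head_mem_region _ _
      refine (Finset.card_le_card hsub).trans ?_
      rw [Finset.card_product]
      simp
    have h₃ : ((P.filter fun p => ¬(nb p).1 ∈ F).card : ℝ) ≤ G.card * 4 := by exact_mod_cast h₂
    rw [nsmul_eq_mul] at h₁
    nlinarith [sq_nonneg (B + D)]
  have hsum := Finset.sum_filter_add_sum_filter_not P (fun p => (nb p).1 ∈ F)
    fun p => conjArea S p.1 p.2
  rw [hinner, zero_add] at hsum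
  rw [hsum, ← htotal, abs_mul, abs_of_pos hc] at houter
  rw [div_mul_eq_mul_div, le_div_iff₀ hc]
  linarith

end

section
/-! ### Counting the points of the net in squares -/

/-- The square `[a, a + R] × [b, b + R]`, enlarged by `t` on all sides. -/
def box (a b R t : ℝ) : Set ℂ := Set.Icc (a - t) (a + R + t) ×ℂ Set.Icc (b - t) (b + R + t)

lemma square_eq_box (i j₁ j₂ : ℕ) : square i j₁ j₂ = box j₁ j₂ (2 ^ i) 0 := by
  simp [square, box]

lemma measurableSet_box (a b R t : ℝ) : MeasurableSet (box a b R t) :=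
  (isClosed_Icc.reProdIm isClosed_Icc).measurableSet

lemma volume_box (a b : ℝ) {R t : ℝ} (h : 0 ≤ R + 2 * t) :
    volume (box a b R t) = ENNReal.ofReal ((R + 2 * t) ^ 2) := by
  have : box a b R t = Complex.measurableEquivRealProd ⁻¹'
      (Set.Icc (a - t) (a + R + t) ×ˢ Set.Icc (b - t) (b + R + t)) := rfl
  rw [this, Complex.volume_preserving_equiv_real_prod.measure_preimage
    (measurableSet_Icc.prod measurableSet_Icc).nullMeasurableSet, Measure.volume_eq_prod,
    Measure.prod_prod, Real.volume_Icc, Real.volume_Icc,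
    ← ENNReal.ofReal_mul (by linarith)]
  congr 1; ring

lemma mem_box_of_dist {a b R t s : ℝ} {z w : ℂ} (hz : z ∈ box a b R t) (h : dist z w ≤ s) :
    w ∈ box a b R (t + s) := by
  rw [dist_eq_norm] at h
  have h₁ := (Complex.abs_re_le_norm _).trans h
  have h₂ := (Complex.abs_im_le_norm _).trans h
  rw [Complex.sub_re, abs_le] at h₁
  rw [Complex.sub_im, abs_le] at h₂
  obtain ⟨⟨h₃, h₄⟩, h₅, h₆⟩ := hz
  refine ⟨⟨?_, ?_⟩, ?_, ?_⟩ <;> linarith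

variable {τ : Set Tile}

lemma IsPenroseTiling.exists_mem (hτ : IsPenroseTiling τ) (z : ℂ) : ∃ T ∈ τ, z ∈ T.region := by
  have : z ∈ ⋃ T ∈ τ, T.region := by rw [hτ.covers]; trivial
  simpa using this

lemma IsPenroseTiling.finite_points (hτ : IsPenroseTiling τ) {p : Tile → ℂ}
    (hp : ∀ T ∈ τ, p T ∈ T.region) (a b R : ℝ) (hR : 0 ≤ R) :
    {T ∈ τ | p T ∈ box a b R 0}.Finite := by
  refine (hτ.finite_of_subset (W := box a b R 2) ?_).subset fun T hT => ⟨hT.1, fun z hz => ?_⟩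
  · rw [volume_box _ _ (by linarith)]; exact ENNReal.ofReal_ne_top
  · simpa using mem_box_of_dist hT.2 (Tile.dist_le_two (hp T hT.1) hz)

/-- The number of tiles whose distinguished points lie in a square is the area of the square times
the density, up to an error of the order of the edge length. -/
theorem IsPenroseTiling.exists_count_bound (hτ : IsPenroseTiling τ) {p : Tile → ℂ}
    (hp : ∀ T ∈ τ, p T ∈ T.region) :
    ∃ C, 0 ≤ C ∧ ∀ (a b R : ℝ), 8 ≤ R → ∀ F : Finset Tile,
      (∀ T, T ∈ F ↔ T ∈ τ ∧ p T ∈ box a b R 0) →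
      |F.card - φ ^ 2 / ((1 + φ ^ 2) * dartArea) * R ^ 2| ≤ C * R := by
  obtain ⟨C, hC0, hC⟩ := hτ.exists_conjWeight_bound
  have hA := dartArea_pos
  have g := phi_gt
  have hφ := phi_sq
  set A := dartArea with hAdef
  set α : ℝ := φ ^ 2 / (1 + φ ^ 2) with hα
  have hα0 : 0 ≤ α := by positivity
  have hα1 : α ≤ 1 := by rw [hα, div_le_one (by positivity)]; linarith
  refine ⟨α * (24 / A) + C * (24 / A), by positivity, fun a b R hR F hF => ?_⟩
  have hFτ : (F : Set Tile) ⊆ τ := fun T hT => ((hF T).1 hT).1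
  have hin : ∀ T ∈ F, T.region ⊆ box a b R 2 := by
    intro T hT z hz
    obtain ⟨h₁, h₂⟩ := (hF T).1 hT
    simpa using mem_box_of_dist h₂ (Tile.dist_le_two (hp T h₁) hz)
  have upper : (∑ T ∈ F, T.kind.axis) * A ≤ (R + 4) ^ 2 := by
    refine hτ.sum_axis_le hFτ (sq_nonneg _) ?_ hin
    rw [volume_box _ _ (by linarith)]; norm_num
  have lower : (R - 4) ^ 2 ≤ (∑ T ∈ F, T.kind.axis) * A := by
    refine le_sum_axis (W := box a b R (-2)) ?_ fun z hz => ?_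
    · rw [volume_box _ _ (by linarith)]
      apply ENNReal.ofReal_le_ofReal
      apply le_of_eq; ring
    · obtain ⟨T, hT, hzT⟩ := hτ.exists_mem z
      refine Set.mem_iUnion₂.2 ⟨T, (hF T).2 ⟨hT, ?_⟩, hzT⟩
      simpa using mem_box_of_dist hz (Tile.dist_le_two hzT (hp T hT))
  -- The ring contains every tile of `F` that touches a tile outside `F`: from a point at depth 4,
  -- two tile diameters would still place the point of the other tile in the square. Its area is (R
  -- + 4)² - (R - 8)² ≤ 24R.
  have hring : volume (box a b R 2 \ box a b R (-4)) ≤ ENNReal.ofReal (24 * R) := by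
    have hsub : box a b R (-4) ⊆ box a b R 2 := by
      rintro z ⟨⟨h₁, h₂⟩, h₃, h₄⟩
      refine ⟨⟨?_, ?_⟩, ?_, ?_⟩ <;> linarith
    rw [measure_sdiff hsub (measurableSet_box _ _ _ _).nullMeasurableSet,
      volume_box _ _ (by linarith),
      volume_box _ _ (by linarith), ← ENNReal.ofReal_sub _ (sq_nonneg _)]
    · apply ENNReal.ofReal_le_ofReal; nlinarith
    · rw [volume_box _ _ (by linarith)]; exact ENNReal.ofReal_ne_top
  have hfin : {T ∈ τ | T.region ⊆ box a b R 2 \ box a b R (-4)}.Finite :=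
    hτ.finite_of_subset (hring.trans_lt ENNReal.ofReal_lt_top).ne
  have hG := hC F hfin.toFinset hFτ ?_
  · have hcard : (hfin.toFinset.card : ℝ) * A ≤ 24 * R := by
      refine hτ.card_le (fun T hT => (hfin.mem_toFinset.1 hT).1) (by linarith) hring
        fun T hT => (hfin.mem_toFinset.1 hT).2
    have hcard' : (hfin.toFinset.card : ℝ) ≤ 24 / A * R := by
      rw [div_mul_eq_mul_div, le_div_iff₀ hA]; exact hcard
    -- The constant α is chosen so that 1 = αφ + (α - 1)(φ - 1) for a kite; for a dart, 1 = α - (α -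
    -- 1) holds anyway.
    have hdecomp : (F.card : ℝ)
        = α * (∑ T ∈ F, T.kind.axis) + (α - 1) * ∑ T ∈ F, T.kind.conjWeight := by
      rw [Finset.mul_sum, Finset.mul_sum, ← Finset.sum_add_distrib, ← nsmul_one, ← Finset.sum_const]
      refine Finset.sum_congr rfl fun T _ => ?_
      have hαe : α * (φ + 2) = φ + 1 := by
        rw [hα, hφ, div_mul_eq_mul_div, div_eq_iff (by linarith)]; ring
      have hαe' : α * (2 * φ - 1) = φ := by
        have h2 : (φ + 2) * (α * (2 * φ - 1)) = (φ + 2) * φ := by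
          linear_combination (2 * φ - 1) * hαe + hφ
        exact mul_left_cancel₀ (by linarith) h2
      cases T.kind <;> simp only [Kind.axis, Kind.conjWeight] <;> linarith
    have harea : |(∑ T ∈ F, T.kind.axis) - R ^ 2 / A| ≤ 24 / A * R := by
      have e : (∑ T ∈ F, T.kind.axis) - R ^ 2 / A = ((∑ T ∈ F, T.kind.axis) * A - R ^ 2) / A := by
        field_simp
      rw [e, abs_div, abs_of_pos hA, div_mul_eq_mul_div]
      apply div_le_div_of_nonneg_right _ hA.le
      rw [abs_le]; constructor <;> nlinarith
    have e : F.card - φ ^ 2 / ((1 + φ ^ 2) * A) * R ^ 2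
        = α * ((∑ T ∈ F, T.kind.axis) - R ^ 2 / A) + (α - 1) * ∑ T ∈ F, T.kind.conjWeight := by
      rw [hdecomp, ← div_div]; ring
    rw [e]
    refine (abs_add_le _ _).trans ?_
    rw [abs_mul, abs_mul, abs_of_nonneg hα0, add_mul]
    have hα2 : |α - 1| ≤ 1 := by rw [abs_le]; constructor <;> linarith
    refine add_le_add ?_ ?_
    · rw [mul_assoc]; exact mul_le_mul_of_nonneg_left harea hα0
    · calc |α - 1| * |∑ T ∈ F, T.kind.conjWeight| ≤ 1 * |∑ T ∈ F, T.kind.conjWeight| :=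
            mul_le_mul_of_nonneg_right hα2 (abs_nonneg _)
        _ = |∑ T ∈ F, T.kind.conjWeight| := one_mul _
        _ ≤ C * hfin.toFinset.card := hG
        _ ≤ C * (24 / A * R) := mul_le_mul_of_nonneg_left hcard' hC0
        _ = C * (24 / A) * R := by ring
  · rintro T hT T' hT' hT'F ⟨s, hs, hs'⟩
    refine hfin.mem_toFinset.2 ⟨hFτ hT, fun z hz => ⟨hin T hT hz, fun hz' => hT'F ?_⟩⟩
    refine (hF T').2 ⟨hT', ?_⟩
    have h₁ := mem_box_of_dist hz' (Tile.dist_le_two hz hs)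
    have h₂ := mem_box_of_dist h₁ (Tile.dist_le_two hs' (hp T' hT'))
    norm_num at h₂
    exact h₂

end

section
/-! ### Convergence of the product -/

lemma prod_Icc_mono {a : ℕ → ℝ≥0∞} (h : ∀ i, 1 ≤ a i) (k : ℕ) :
    Monotone fun n => ∏ i ∈ Finset.Icc k n, a i := fun _ _ hmn =>
  Finset.prod_le_prod_of_subset_of_one_le' (Finset.Icc_subset_Icc_right hmn) fun i _ _ => h i

/-- The partial products increase, and they are bounded because 1 + x ≤ exp x and ∑ c/2^i ≤ 2c.
Finiteness of the factors up to `i₀` takes care of the start. -/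
lemma productConverges_of_le {a : ℕ → ℝ≥0∞} {k i₀ : ℕ} {c : ℝ} (hc : 0 ≤ c) (h₁ : ∀ i, 1 ≤ a i)
    (h₂ : ∀ i, k ≤ i → a i ≠ ∞) (h₃ : ∀ i, i₀ ≤ i → a i ≤ ENNReal.ofReal (1 + c / 2 ^ i)) :
    ProductConverges k a := by
  have hmono := prod_Icc_mono h₁ k
  set P : ℕ → ℝ≥0∞ := fun n => ∏ i ∈ Finset.Icc k n, a i with hP
  have hA : P i₀ ≠ ∞ := ENNReal.prod_ne_top fun i hi => h₂ i (Finset.mem_Icc.1 hi).1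
  have hstep : ∀ n, P (n + 1) ≤ P n * a (n + 1) := by
    intro n
    simp only [hP]
    rcases le_or_gt k (n + 1) with hk | hk
    · exact (Finset.prod_Icc_succ_top hk _).le
    · rw [Finset.Icc_eq_empty (by omega), Finset.Icc_eq_empty (by omega), Finset.prod_empty,
        one_mul]
      exact h₁ _
  have hbound : ∀ n,
      P n ≤ P i₀ * ENNReal.ofReal (Real.exp (∑ i ∈ Finset.range (n + 1), c / 2 ^ i)) := by
    intro n
    rcases le_total n i₀ with hn | hn
    · refine (hmono hn).trans (le_mul_of_one_le_right' ?_)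
      rw [ENNReal.one_le_ofReal]
      exact Real.one_le_exp (Finset.sum_nonneg fun i _ => by positivity)
    · induction n, hn using Nat.le_induction with
      | base =>
        refine le_mul_of_one_le_right' ?_
        rw [ENNReal.one_le_ofReal]
        exact Real.one_le_exp (Finset.sum_nonneg fun i _ => by positivity)
      | succ n hn ih =>
        refine (hstep n).trans ?_
        rw [Finset.sum_range_succ, Real.exp_add, ENNReal.ofReal_mul (Real.exp_pos _).le,
          ← mul_assoc]
        refine mul_le_mul' ih ((h₃ _ (by omega)).trans (ENNReal.ofReal_le_ofReal ?_))
        linarith [Real.add_one_le_exp (c / 2 ^ (n + 1))]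
  have hsum : ∀ n, ∑ i ∈ Finset.range n, c / 2 ^ i ≤ c * 2 := by
    intro n
    have hs := summable_geometric_two
    have := hs.sum_le_tsum (Finset.range n) fun i _ => by positivity
    rw [tsum_geometric_two] at this
    have e : ∑ i ∈ Finset.range n, c / 2 ^ i = c * ∑ i ∈ Finset.range n, (1 / 2 : ℝ) ^ i := by
      rw [Finset.mul_sum]
      refine Finset.sum_congr rfl fun i _ => ?_
      rw [one_div, inv_pow]; rfl
    rw [e]
    exact mul_le_mul_of_nonneg_left this hc
  have hsup : ⨆ n, P n ≤ P i₀ * ENNReal.ofReal (Real.exp (c * 2)) := by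
    refine iSup_le fun n => (hbound n).trans (mul_le_mul' le_rfl (ENNReal.ofReal_le_ofReal ?_))
    exact Real.exp_le_exp.2 (hsum _)
  have hne : ⨆ n, P n ≠ ∞ := ne_top_of_le_ne_top (ENNReal.mul_ne_top hA ENNReal.ofReal_ne_top) hsup
  refine ⟨(⨆ n, P n).toNNReal, ?_, ?_⟩
  · refine ENNReal.toNNReal_pos ?_ hne
    have : 1 ≤ ⨆ n, P n := le_iSup_of_le 0 (Finset.one_le_prod' fun i _ => h₁ i)
    exact (zero_lt_one.trans_le this).ne'
  · rw [ENNReal.coe_toNNReal hne]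
    exact tendsto_atTop_iSup hmono

lemma volume_square (i j₁ j₂ : ℕ) :
    volume (square i j₁ j₂) = ENNReal.ofReal (((2 : ℝ) ^ i) ^ 2) := by
  rw [square_eq_box, volume_box _ _ (by positivity), mul_zero, add_zero]

lemma one_le_e {Y : Set ℂ} {ρ : ℝ} (hρ : 0 < ρ) (i j₁ j₂ : ℕ) : 1 ≤ e Y ρ (square i j₁ j₂) := by
  rw [e, volume_square, ← ENNReal.ofReal_mul hρ.le]
  have h0 : ENNReal.ofReal (ρ * ((2 : ℝ) ^ i) ^ 2) ≠ 0 :=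
    (ENNReal.ofReal_pos.2 (by positivity)).ne'
  have ht : ENNReal.ofReal (ρ * ((2 : ℝ) ^ i) ^ 2) ≠ ∞ := ENNReal.ofReal_ne_top
  rw [le_max_iff, ENNReal.le_div_iff_mul_le (Or.inr h0) (Or.inr ht),
    ENNReal.le_div_iff_mul_le (Or.inl h0) (Or.inl ht), one_mul, one_mul]
  exact le_total _ _

lemma one_le_E {Y : Set ℂ} {ρ : ℝ} (hρ : 0 < ρ) (i : ℕ) : 1 ≤ E Y ρ i :=
  (one_le_e hρ i 0 0).trans (le_iSup₂ (f := fun j₁ j₂ => e Y ρ (square i j₁ j₂)) 0 0)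

lemma e_le {Y : Set ℂ} {ρ : ℝ} (hρ : 0 < ρ) {i j₁ j₂ n : ℕ} (hn : 0 < n)
    (hcard : (square i j₁ j₂ ∩ Y).encard = n) {b : ℝ} (h₁ : ρ * ((2 : ℝ) ^ i) ^ 2 ≤ b * n)
    (h₂ : n ≤ b * (ρ * ((2 : ℝ) ^ i) ^ 2)) : e Y ρ (square i j₁ j₂) ≤ ENNReal.ofReal b := by
  have hn' : (0 : ℝ) < n := by exact_mod_cast hn
  have hb : 0 ≤ b := by
    by_contra hb
    have : 0 < ρ * ((2 : ℝ) ^ i) ^ 2 := by positivity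
    nlinarith
  have hcast : (((n : ℕ∞) : ℝ≥0∞)) = ENNReal.ofReal n := by
    rw [ENNReal.ofReal_natCast]; rfl
  rw [e, volume_square, ← ENNReal.ofReal_mul hρ.le, hcard, hcast,
    ← ENNReal.ofReal_div_of_pos hn', ← ENNReal.ofReal_div_of_pos (by positivity)]
  refine max_le (ENNReal.ofReal_le_ofReal ?_) (ENNReal.ofReal_le_ofReal ?_)
  · rw [div_le_iff₀ hn']; exact h₁
  · rw [div_le_iff₀ (by positivity)]; exact h₂

variable {τ : Set Tile} {p : Tile → ℂ}

lemma encard_square_inter (hinj : Set.InjOn p τ) (i j₁ j₂ : ℕ) {F : Finset Tile}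
    (hF : ∀ T, T ∈ F ↔ T ∈ τ ∧ p T ∈ box j₁ j₂ (2 ^ i) 0) :
    (square i j₁ j₂ ∩ p '' τ).encard = F.card := by
  have : square i j₁ j₂ ∩ p '' τ = p '' (F : Set Tile) := by
    ext z
    constructor
    · rintro ⟨hz, T, hT, rfl⟩
      exact ⟨T, (hF T).2 ⟨hT, by rwa [← square_eq_box]⟩, rfl⟩
    · rintro ⟨T, hT, rfl⟩
      obtain ⟨h₁, h₂⟩ := (hF T).1 hT
      exact ⟨by rwa [square_eq_box], T, h₁, rfl⟩
  rw [this, Set.InjOn.encard_image (hinj.mono fun T hT => ((hF T).1 hT).1),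
    Set.encard_coe_eq_coe_finsetCard]

lemma IsPenroseTiling.exists_finset (hτ : IsPenroseTiling τ) (hp : ∀ T ∈ τ, p T ∈ T.region)
    (a b R : ℝ) (hR : 0 ≤ R) : ∃ F : Finset Tile, ∀ T, T ∈ F ↔ T ∈ τ ∧ p T ∈ box a b R 0 :=
  ⟨(hτ.finite_points hp a b R hR).toFinset, fun T => by simp⟩

/-- Packing bounds the number of points of a square from above independently of its position, and by
hypothesis there is at least one. -/
lemma IsPenroseTiling.E_ne_top (hτ : IsPenroseTiling τ) (hp : ∀ T ∈ τ, p T ∈ T.region)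
    (hinj : Set.InjOn p τ) {ρ : ℝ} (hρ : 0 < ρ) (i : ℕ)
    (h : ∀ j₁ j₂ : ℕ, (square i j₁ j₂ ∩ p '' τ).Nonempty) : E (p '' τ) ρ i ≠ ∞ := by
  have hA := dartArea_pos
  set a : ℝ := ρ * ((2 : ℝ) ^ i) ^ 2 with ha
  have ha0 : 0 < a := by positivity
  set M : ℝ := ((2 : ℝ) ^ i + 4) ^ 2 / dartArea with hM
  have hM0 : 0 ≤ M := by positivity
  -- With 1 ≤ n ≤ M points, the two quotients a/n and n/a are at most a and M/a.
  refine ne_top_of_le_ne_top (ENNReal.ofReal_ne_top (r := a + M / a)) (iSup₂_le fun j₁ j₂ => ?_)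
  obtain ⟨F, hF⟩ := hτ.exists_finset hp j₁ j₂ (2 ^ i) (by positivity)
  have hcard := encard_square_inter hinj i j₁ j₂ hF
  have hpos : 0 < F.card := by
    have := Set.encard_ne_zero.2 (h j₁ j₂)
    rw [hcard] at this
    exact Nat.pos_of_ne_zero fun h0 => this (by rw [h0]; rfl)
  have hle : (F.card : ℝ) ≤ M := by
    rw [hM, le_div_iff₀ hA]
    refine hτ.card_le (fun T hT => ((hF T).1 hT).1) (sq_nonneg _)
      (W := box j₁ j₂ (2 ^ i) 2) ?_ fun T hT z hz => ?_
    · rw [volume_box _ _ (by positivity)]; norm_num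
    · obtain ⟨h₁, h₂⟩ := (hF T).1 hT
      simpa using mem_box_of_dist h₂ (Tile.dist_le_two (hp T h₁) hz)
  have h1 : (1 : ℝ) ≤ F.card := by exact_mod_cast hpos
  refine e_le hρ hpos hcard ?_ ?_
  · have : 0 ≤ M / a := by positivity
    nlinarith
  · rw [← ha, add_mul, div_mul_cancel₀ _ ha0.ne']
    nlinarith [mul_pos ha0 ha0]

/-- From side 4 on, a square contains a point at distance at least 2 from all sides. A tile through
it has diameter at most 2 and stays inside the square. -/
lemma IsPenroseTiling.square_nonempty (hτ : IsPenroseTiling τ) (hp : ∀ T ∈ τ, p T ∈ T.region)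
    {i : ℕ} (hi : 2 ≤ i) (j₁ j₂ : ℕ) : (square i j₁ j₂ ∩ p '' τ).Nonempty := by
  have h4 : (4 : ℝ) ≤ 2 ^ i := by
    calc (4 : ℝ) = 2 ^ 2 := by norm_num
      _ ≤ 2 ^ i := pow_le_pow_right₀ (by norm_num) hi
  obtain ⟨T, hT, hz⟩ := hτ.exists_mem ⟨j₁ + 2, j₂ + 2⟩
  have hmem : (⟨j₁ + 2, j₂ + 2⟩ : ℂ) ∈ box j₁ j₂ (2 ^ i) (-2) := by
    refine ⟨⟨?_, ?_⟩, ?_, ?_⟩ <;> simp only <;> linarith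
  refine ⟨p T, ?_, T, hT, rfl⟩
  rw [square_eq_box]
  simpa using mem_box_of_dist hmem (Tile.dist_le_two hz (hp T hT))

lemma IsPenroseTiling.exists_E_le (hτ : IsPenroseTiling τ) (hp : ∀ T ∈ τ, p T ∈ T.region)
    (hinj : Set.InjOn p τ) {ρ : ℝ} (hρ : 0 < ρ)
    (hρ' : ρ = φ ^ 2 / ((1 + φ ^ 2) * dartArea)) :
    ∃ c, 0 ≤ c ∧ ∃ i₀, ∀ i, i₀ ≤ i → E (p '' τ) ρ i ≤ ENNReal.ofReal (1 + c / 2 ^ i) := by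
  obtain ⟨C, hC0, hC⟩ := hτ.exists_count_bound hp
  refine ⟨2 * C / ρ, by positivity, ?_⟩
  -- Beyond this index the counting estimate applies and its error CR is at most half of ρR². So the
  -- count is at least ρR²/2, which accounts for the factor 2 in `2 * C / ρ`.
  obtain ⟨i₀, hi₀⟩ := pow_unbounded_of_one_lt (max 8 (2 * C / ρ)) (one_lt_two (α := ℝ))
  refine ⟨i₀, fun i hi => iSup₂_le fun j₁ j₂ => ?_⟩
  have hR : max 8 (2 * C / ρ) ≤ (2 : ℝ) ^ i :=
    hi₀.le.trans (pow_le_pow_right₀ (by norm_num) hi)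
  set R : ℝ := 2 ^ i with hRdef
  have hR8 : 8 ≤ R := (le_max_left _ _).trans hR
  have hRC : 2 * C ≤ R * ρ := (div_le_iff₀ hρ).1 ((le_max_right _ _).trans hR)
  obtain ⟨F, hF⟩ := hτ.exists_finset hp j₁ j₂ R (by linarith)
  have hest := hC j₁ j₂ R hR8 F hF
  rw [← hρ', abs_le] at hest
  have hcard := encard_square_inter hinj i j₁ j₂ hF
  have hR0 : 0 < R := by linarith
  have hhalf : C * R ≤ ρ * R ^ 2 / 2 := by nlinarith
  have hlow : ρ * R ^ 2 / 2 ≤ F.card := by linarith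
  have hposR : 0 < ρ * R ^ 2 := by positivity
  have hpos : 0 < F.card := by
    have : (0 : ℝ) < F.card := by linarith
    exact_mod_cast this
  refine e_le hρ hpos hcard ?_ ?_
  · have h₁ : 2 * C / ρ / R * (ρ * R ^ 2 / 2) = C * R := by field_simp
    have h₂ : 2 * C / ρ / R * (ρ * R ^ 2 / 2) ≤ 2 * C / ρ / R * F.card :=
      mul_le_mul_of_nonneg_left hlow (by positivity)
    linarith
  · have h₁ : 2 * C / ρ / R * (ρ * R ^ 2) = 2 * (C * R) := by field_simp
    rw [add_mul, h₁]
    linarith [mul_nonneg hC0 hR0.le]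

end

end

end Penrose

theorem mainTheorem1 (τ : Set Penrose.Tile) (hτ : Penrose.IsPenroseTiling τ)
    (Y : Set ℂ) (hY : Penrose.IsNetCreatedBy Y τ)
    (ρ : ℝ) (hρ : ρ = φ ^ 2 / ((1 + φ ^ 2) * Penrose.dartArea)) :
    Penrose.ProductConverges 2 (Penrose.E Y ρ) ∧
      ((∀ j₁ j₂ : ℕ, (Penrose.square 1 j₁ j₂ ∩ Y).Nonempty) →
        Penrose.ProductConverges 1 (Penrose.E Y ρ)) := by
  obtain ⟨-, p, hp, hinj, rfl⟩ := hY
  have hρ0 : 0 < ρ := by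
    have := Penrose.dartArea_pos
    have := Penrose.phi_gt
    rw [hρ]; positivity
  obtain ⟨c, hc, i₀, hle⟩ := hτ.exists_E_le hp hinj hρ0 hρ
  have hfin : ∀ i, 2 ≤ i → Penrose.E (p '' τ) ρ i ≠ ∞ := fun i hi =>
    hτ.E_ne_top hp hinj hρ0 i (hτ.square_nonempty hp hi)
  refine ⟨Penrose.productConverges_of_le hc (Penrose.one_le_E hρ0) hfin hle, fun h => ?_⟩
  refine Penrose.productConverges_of_le hc (Penrose.one_le_E hρ0) (fun i hi => ?_) hle
  rcases hi.eq_or_lt with rfl | hi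
  · exact hτ.E_ne_top hp hinj hρ0 1 h
  · exact hfin i hi
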